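/- **Setting.** There are $N\ge 3$ buyers with unit demand. Their private valuations $X_1,\dots,X_N$ are independent with common distribution $F$, which has support $[\underline x,\bar x]$, $0\le\underline x<\bar x$, and a density $f$ that is continuous on $[\underline x,\bar x]$ and positive on $[\underline x,\bar x)$. The virtual value $\psi(x)=x-\frac{1-F(x)}{f(x)}$ is increasing on $[\underline x,\bar x]$ (with $\psi(\bar x)=\bar x$). Write $x_{(1)}\ge x_{(2)}\ge\dots\ge x_{(N)}$ for the entries of a vector $x$ in decreasing order. A first seller has one unit of a good. Afterwards every buyer who did not get it takes part in a second-price auction, without reserve price, for a second identical unit, and bids his valuation there. Thus a buyer with valuation $v$ who does not get the first unit receives from the second auction $\max\{v-w,0\}$, where $w$ is the highest valuation among the other buyers who did not get the first unit. A direct mechanism for the first seller assigns to each report vector $x\in[\underline x,\bar x]^N$ probabilities $P_i(x)\ge 0$ with $\sum_i P_i(x)\le 1$ (buyer $i$ gets the first unit) and payments $t_i(x)\in\mathbb R$ (measurable in $x$, with finite expectation both ex ante and conditionally on each own report). It is incentive compatible if, for every buyer and every valuation, truthful reporting maximizes his interim expected total payoff (from both sellers, net of $t_i$) when the others report truthfully.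 It is individually rational if, for every buyer $i$ and valuation $x_i$, this truthful payoff is at least $E\max\{x_i-\max_{j\ne i}X_j,0\}$, his expected payoff from the second auction when the first unit is not allocated. A mechanism is optimal if it is incentive compatible and individually rational and maximizes the expected revenue $E\sum_i t_i(X)$ among all such direct mechanisms. For $x\in[\underline x,\bar x]$ let $a(x)=\min\{a\in[\underline x,\bar x]: a\ge x,\ a+\psi(a)\ge x\}$. **Theorem.** The minimum defining $a(x)$ exists, and the following direct mechanism (ties between buyers are broken uniformly at random) is optimal. 1. *Allocation.* The first unit goes to the buyer with the second-highest valuation if $\psi(x_{(2)})+x_{(2)}-x_{(3)}\ge 0$, equivalently $x_{(2)}\ge a(x_{(3)})$, and is not allocated otherwise. 2. *Payments.* (a) If $\psi(x_{(3)})<0$ and the unit is allocated, the buyer with the highest valuation pays $a(x_{(3)})-x_{(3)}>0$, the buyer with the second-highest valuation pays $a(x_{(3)})>0$, and the others pay nothing. (b) If $\psi(x_{(3)})\ge 0$, then $a(x_{(3)})=x_{(3)}$, the unit is allocated, the buyer with the second-highest valuation pays $x_{(3)}>0$, and the others pay nothing. (c) If the unit is not allocated, nobody pays anything. 3. *Revenue.*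 The expected revenue of this mechanism is $E\max\{\psi(X_{(2)})+X_{(2)}-X_{(3)},\,0\}$. -/

import Mathlib

open MeasureTheory ProbabilityTheory Set

noncomputable section

namespace SeqAuction

/-- The virtual valuation `ψ(x) = x - (1 - F(x)) / f(x)`, where `F` is the distribution function
of `μ` and `f` its density. -/
def virtualValue (μ : Measure ℝ) (f : ℝ → ℝ) (x : ℝ) : ℝ :=
  x - (1 - cdf μ x) / f x

/-- The feasible values of `a` in the definition of the threshold `a(x)`:
those `a ∈ [lo, hi]` with `a ≥ x` and `a + ψ(a) ≥ x`. -/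
def thresholdSet (lo hi : ℝ) (μ : Measure ℝ) (f : ℝ → ℝ) (x : ℝ) : Set ℝ :=
  {a | a ∈ Icc lo hi ∧ x ≤ a ∧ x ≤ a + virtualValue μ f a}

/-- The threshold `a(x) = min {a ≥ x : a + ψ(a) ≥ x}`. -/
def threshold (lo hi : ℝ) (μ : Measure ℝ) (f : ℝ → ℝ) (x : ℝ) : ℝ :=
  sInf (thresholdSet lo hi μ f x)

section Buyers

variable {N : ℕ}

/-- The entries of `x` from highest to lowest: `orderStat x 0` is the highest entry,
`orderStat x 1` the second highest, and so on. -/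
def orderStat (x : Fin N → ℝ) (k : Fin N) : ℝ :=
  x (Tuple.sort (fun i => OrderDual.toDual (x i)) k)

/-- All ways to rank the buyers from highest to lowest report (`σ k` is the buyer in position `k`);
there is more than one exactly when there are ties. -/
def rankings (x : Fin N → ℝ) : Finset (Equiv.Perm (Fin N)) :=
  open Classical in Finset.univ.filter fun σ => Antitone fun k => x (σ k)

/-- The joint law of `N` independent valuations, each with law `μ`. -/
def jointLaw (N : ℕ) (μ : Measure ℝ) : Measure (Fin N → ℝ) :=
  Measure.pi fun _ => μ

/-- A direct mechanism: for each vector of reports `x`, the probability `alloc x i` that buyer `i`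
gets the first seller's good, and the payment `pay x i` of buyer `i` to the first seller. -/
structure DirectMechanism (N : ℕ) where
  alloc : (Fin N → ℝ) → Fin N → ℝ
  pay : (Fin N → ℝ) → Fin N → ℝ

/-- Payoff of buyer `i` in a second-price auction without reserve price against the set `S` of
rivals, everyone bidding the valuation `v`: the excess, if positive, of `v i` over the highest rival
valuation (zero if there is no rival). -/
def secondAuctionPayoff (v : Fin N → ℝ) (S : Finset (Fin N)) (i : Fin N) : ℝ :=
  max (v i - S.fold max 0 v) 0

/-- Expected payoff of buyer `i`, before the payment to the first seller, when the valuations are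
`v` and the reports are `b`. If `i` gets the first good, the payoff is `v i`. If another buyer `j`
gets it, then `i` meets all buyers other than `i` and `j` in the second auction. If nobody gets it,
then `i` meets all other buyers there. -/
def DirectMechanism.grossPayoff (M : DirectMechanism N) (v b : Fin N → ℝ) (i : Fin N) : ℝ :=
  M.alloc b i * v i
    + ∑ j ∈ Finset.univ.erase i,
        M.alloc b j * secondAuctionPayoff v ((Finset.univ.erase i).erase j) i
    + (1 - ∑ j, M.alloc b j) * secondAuctionPayoff v (Finset.univ.erase i) i

/-- Interim expected payoff, net of the payment, of buyer `i` with valuation `x` who reports `q`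
while the others report truthfully. (The `i`-th coordinate of `y` is overwritten.) -/
def DirectMechanism.interimPayoff (M : DirectMechanism N) (μ : Measure ℝ) (i : Fin N)
    (q x : ℝ) : ℝ :=
  ∫ y, (M.grossPayoff (Function.update y i x) (Function.update y i q) i
    - M.pay (Function.update y i q) i) ∂(jointLaw N μ)

/-- Expected payoff of buyer `i` with valuation `x` from the second auction alone, when the first
good is given to nobody. -/
def outsideOption (N : ℕ) (μ : Measure ℝ) (i : Fin N) (x : ℝ) : ℝ :=
  ∫ y, secondAuctionPayoff (Function.update y i x) (Finset.univ.erase i) i ∂(jointLaw N μ)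

/-- Expected revenue of the first seller under truthful reports. -/
def DirectMechanism.revenue (M : DirectMechanism N) (μ : Measure ℝ) : ℝ :=
  ∫ x, ∑ i, M.pay x i ∂(jointLaw N μ)

/-- The direct mechanisms among which the first seller chooses, the type space being `[lo, hi]`. -/
structure DirectMechanism.IsAdmissible (M : DirectMechanism N) (lo hi : ℝ) (μ : Measure ℝ) :
    Prop where
  measurable_alloc : ∀ i, Measurable fun x => M.alloc x i
  measurable_pay : ∀ i, Measurable fun x => M.pay x i
  /-- expected payments exist, ex ante and for each own report -/
  integrable_pay : ∀ i, Integrable (fun x => M.pay x i) (jointLaw N μ)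
  integrable_interim_pay : ∀ i, ∀ q ∈ Icc lo hi,
    Integrable (fun y => M.pay (Function.update y i q) i) (jointLaw N μ)
  /-- allocation probabilities are nonnegative and sum to at most one -/
  alloc_nonneg : ∀ x : Fin N → ℝ, (∀ i, x i ∈ Icc lo hi) → ∀ i, 0 ≤ M.alloc x i
  alloc_sum_le_one : ∀ x : Fin N → ℝ, (∀ i, x i ∈ Icc lo hi) → ∑ i, M.alloc x i ≤ 1
  /-- Bayesian incentive compatibility -/
  incentive_compatible : ∀ i, ∀ x ∈ Icc lo hi, ∀ q ∈ Icc lo hi,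
    M.interimPayoff μ i q x ≤ M.interimPayoff μ i x x
  /-- interim individual rationality -/
  individually_rational : ∀ i, ∀ x ∈ Icc lo hi, outsideOption N μ i x ≤ M.interimPayoff μ i x x

/-- A revenue-maximizing direct mechanism for the first seller. -/
def DirectMechanism.IsOptimal (M : DirectMechanism N) (lo hi : ℝ) (μ : Measure ℝ) : Prop :=
  M.IsAdmissible lo hi μ ∧
    ∀ M' : DirectMechanism N, M'.IsAdmissible lo hi μ → M'.revenue μ ≤ M.revenue μ

variable [NeZero N]

/-- The quantity `ψ(x₍₂₎) + x₍₂₎ - x₍₃₎`. -/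
def marginalRevenue (μ : Measure ℝ) (f : ℝ → ℝ) (x : Fin N → ℝ) : ℝ :=
  virtualValue μ f (orderStat x 1) + orderStat x 1 - orderStat x 2

/-- Probability that the buyer in position `k` gets the good: it goes to the second-highest buyer
(position `1`) if `ψ(x₍₂₎) + x₍₂₎ - x₍₃₎ ≥ 0`, and to nobody otherwise. -/
def rankAlloc (μ : Measure ℝ) (f : ℝ → ℝ) (x : Fin N → ℝ) (k : Fin N) : ℝ :=
  open Classical in if 0 ≤ marginalRevenue μ f x ∧ k = 1 then 1 else 0

/-- Payment of the buyer in position `k`. -/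
def rankPay (lo hi : ℝ) (μ : Measure ℝ) (f : ℝ → ℝ) (x : Fin N → ℝ) (k : Fin N) : ℝ :=
  open Classical in
  if 0 ≤ marginalRevenue μ f x then
    if virtualValue μ f (orderStat x 2) < 0 then
      if k = 0 then threshold lo hi μ f (orderStat x 2) - orderStat x 2
      else if k = 1 then threshold lo hi μ f (orderStat x 2)
      else 0
    else
      if k = 1 then orderStat x 2 else 0
  else 0

/-- The second-highest-bidder mechanism. Ties are broken uniformly at random: a ranking `σ` is drawn
uniformly from the rankings compatible with the reports, and buyer `i` takes position `σ⁻¹ i`. -/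
def secondBidderMechanism (N : ℕ) [NeZero N] (lo hi : ℝ) (μ : Measure ℝ) (f : ℝ → ℝ) :
    DirectMechanism N where
  alloc x i := (∑ σ ∈ rankings x, rankAlloc μ f x (σ⁻¹ i)) / (rankings x).card
  pay x i := (∑ σ ∈ rankings x, rankPay lo hi μ f x (σ⁻¹ i)) / (rankings x).card

end Buyers

end SeqAuction

end

noncomputable section

namespace SeqAuction

/-! Myerson's method applies, with the second auction folded into each buyer's gross payoff. For
fixed reports this payoff is 1-Lipschitz in the own valuation, and its slope is the probability of
obtaining one of the two units. Payments depend on reports only, so incentive compatibility gives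
the envelope formula (`deriv_interimPayoff`). Integration by parts against the prior then writes
expected payments as expected virtual surplus minus the lowest type's payoff (`integral_pay`).

Subtracting the same identity for the inactive mechanism, whose revenue is zero and whose payoffs
are the outside options, gives revenue as `E ∑ⱼ Pⱼ · virtualGain j` minus the lowest types' rents
(`revenue_eq`). Serving the highest or the second-highest buyer yields the same gain, `ψ(x₂) + x₂ -
x₃`, because serving either also changes the second auction's price or winner. Serving a lower buyer
`j` yields only `ψ(xⱼ)`, which is no more. Nonnegative rents thus bound revenue by `E max(ψ(x₂) + x₂
- x₃, 0)` (`revenue_le`).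

The second-bidder mechanism attains the bound. Against the two highest rival reports `r₁ > r₂`, if
`a(r₂) ≤ r₁` a buyer can secure a unit at total price `a(r₂)`, either directly from the first seller
or by paying `a(r₂) - r₂` there and `r₂` later; otherwise his report does not matter. Truth-telling
is therefore optimal profile by profile, off ties (`exPostPayoff_le`), and the lowest type earns
only his outside option. -/

/-- The standing assumptions on the law `μ` of one valuation and its density `f`. -/
structure IsPrior (lo hi : ℝ) (μ : Measure ℝ) (f : ℝ → ℝ) : Prop where
  lo_nonneg : 0 ≤ lo
  lo_lt_hi : lo < hi
  prob : IsProbabilityMeasure μ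
  eq_withDensity : μ = volume.withDensity fun x => ENNReal.ofReal (f x)
  zero_off : ∀ x, x ∉ Icc lo hi → f x = 0
  cont : ContinuousOn f (Icc lo hi)
  pos : ∀ x ∈ Ico lo hi, 0 < f x

/-- The inverse hazard rate `(1 - F) / f`. -/
def invHazard (μ : Measure ℝ) (f : ℝ → ℝ) (x : ℝ) : ℝ := (1 - cdf μ x) / f x

lemma virtualValue_eq (μ : Measure ℝ) (f : ℝ → ℝ) (x : ℝ) :
    virtualValue μ f x = x - invHazard μ f x := rfl

/-! ### The prior: density, virtual value and threshold. -/

namespace IsPrior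

variable {lo hi : ℝ} {μ : Measure ℝ} {f : ℝ → ℝ}

lemma measurable_density (h : IsPrior lo hi μ f) : Measurable f := by
  classical
  have hf : f = (Icc lo hi).piecewise f 0 := by
    ext x
    by_cases hx : x ∈ Icc lo hi
    · simp [hx]
    · simp [hx, h.zero_off x hx]
  rw [hf]
  exact h.cont.measurable_piecewise continuousOn_const measurableSet_Icc

lemma density_nonneg (h : IsPrior lo hi μ f) (x : ℝ) : 0 ≤ f x := by
  by_cases hx : x ∈ Icc lo hi
  · have hcl : x ∈ closure (Ico lo hi) := by rwa [closure_Ico h.lo_lt_hi.ne]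
    refine closure_minimal (s := Ico lo hi) (t := Icc lo hi ∩ f ⁻¹' Ici 0) ?_ ?_ hcl |>.2
    · exact fun y hy => ⟨Ico_subset_Icc_self hy, (h.pos y hy).le⟩
    · exact h.cont.preimage_isClosed_of_isClosed isClosed_Icc isClosed_Ici
  · rw [h.zero_off x hx]

lemma nullSingletonClass (h : IsPrior lo hi μ f) : NullSingletonClass μ := by
  rw [h.eq_withDensity]; infer_instance

lemma integral_eq (h : IsPrior lo hi μ f) (g : ℝ → ℝ) :
    ∫ x, g x ∂μ = ∫ x in lo..hi, f x * g x := by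
  rw [h.eq_withDensity, integral_withDensity_eq_integral_toReal_smul
    h.measurable_density.ennreal_ofReal (by simp), intervalIntegral.integral_of_le h.lo_lt_hi.le,
    ← integral_Icc_eq_integral_Ioc, setIntegral_eq_integral_of_forall_compl_eq_zero]
  · simp [ENNReal.toReal_ofReal, h.density_nonneg]
  · intro x hx
    simp [h.zero_off x hx]

lemma ae_mem_Ioo (h : IsPrior lo hi μ f) : ∀ᵐ x ∂μ, x ∈ Ioo lo hi := by
  have := h.nullSingletonClass
  have h1 : ∀ᵐ x ∂μ, x ∈ Icc lo hi := by
    rw [h.eq_withDensity, ae_withDensity_iff h.measurable_density.ennreal_ofReal]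
    filter_upwards with x hx
    by_contra hn
    simp [h.zero_off x hn] at hx
  have h2 : ∀ᵐ x ∂μ, x ≠ lo := by simp [ae_iff]
  have h3 : ∀ᵐ x ∂μ, x ≠ hi := by simp [ae_iff]
  filter_upwards [h1, h2, h3] with x a b c
  exact ⟨lt_of_le_of_ne a.1 b.symm, lt_of_le_of_ne a.2 c⟩

lemma intervalIntegrable_density (h : IsPrior lo hi μ f) : IntervalIntegrable f volume lo hi :=
  ContinuousOn.intervalIntegrable (by rw [uIcc_of_le h.lo_lt_hi.le]; exact h.cont)

lemma cdf_eq_integral (h : IsPrior lo hi μ f) {x : ℝ} (hx : x ∈ Icc lo hi) :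
    cdf μ x = ∫ t in lo..x, f t := by
  have := h.prob
  have e : ∀ t, f t * (Iic x).indicator 1 t = (Iic x).indicator f t := by
    intro t; by_cases ht : t ∈ Iic x <;> simp [ht]
  rw [cdf_eq_real, ← integral_indicator_one measurableSet_Iic, h.integral_eq,
    intervalIntegral.integral_of_le h.lo_lt_hi.le, intervalIntegral.integral_of_le hx.1]
  simp_rw [e]
  rw [setIntegral_indicator measurableSet_Iic]
  congr 2
  ext t
  simp only [mem_inter_iff, mem_Ioc, mem_Iic]
  have := hx.2
  constructor
  · rintro ⟨⟨a, -⟩, b⟩; exact ⟨a, b⟩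
  · rintro ⟨a, b⟩; exact ⟨⟨a, b.trans this⟩, b⟩

lemma cdf_lo (h : IsPrior lo hi μ f) : cdf μ lo = 0 := by
  rw [h.cdf_eq_integral (left_mem_Icc.2 h.lo_lt_hi.le), intervalIntegral.integral_same]

lemma cdf_hi (h : IsPrior lo hi μ f) : cdf μ hi = 1 := by
  have := h.prob
  rw [h.cdf_eq_integral (right_mem_Icc.2 h.lo_lt_hi.le)]
  have := h.integral_eq 1
  simpa using this.symm

lemma invHazard_nonneg (h : IsPrior lo hi μ f) (x : ℝ) : 0 ≤ invHazard μ f x :=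
  div_nonneg (sub_nonneg.2 (cdf_le_one μ x)) (h.density_nonneg x)

lemma virtualValue_le (h : IsPrior lo hi μ f) (x : ℝ) : virtualValue μ f x ≤ x := by
  have := h.invHazard_nonneg x
  rw [virtualValue_eq]; linarith

/-- The numerator `1 - F(hi)` vanishes, so this holds even if `f hi = 0`, by the convention `0 / 0 =
0`. -/
lemma virtualValue_hi (h : IsPrior lo hi μ f) : virtualValue μ f hi = hi := by
  simp [virtualValue, h.cdf_hi]

lemma measurable_invHazard (h : IsPrior lo hi μ f) : Measurable (invHazard μ f) :=
  (measurable_const.sub (monotone_cdf μ).measurable).div h.measurable_density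

lemma measurable_virtualValue (h : IsPrior lo hi μ f) : Measurable (virtualValue μ f) :=
  measurable_id.sub h.measurable_invHazard

lemma density_mul_invHazard (h : IsPrior lo hi μ f) {x : ℝ} (hx : x ∈ Icc lo hi) :
    f x * invHazard μ f x = 1 - cdf μ x := by
  rcases hx.2.eq_or_lt with rfl | hlt
  · simp [invHazard, h.cdf_hi]
  · rw [invHazard, mul_div_cancel₀ _ (h.pos x ⟨hx.1, hlt⟩).ne']

/-- The density cancels the denominator: against Lebesgue measure the integrand is `1 - F`, bounded
on a compact interval. -/
lemma integrable_invHazard (h : IsPrior lo hi μ f) : Integrable (invHazard μ f) μ := by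
  rw [h.eq_withDensity, integrable_withDensity_iff h.measurable_density.ennreal_ofReal (by simp),
    ← h.eq_withDensity]
  have : Integrable ((Icc lo hi).indicator fun x => 1 - cdf μ x) := by
    rw [integrable_indicator_iff measurableSet_Icc]
    refine Measure.integrableOn_of_bounded (M := 1) (by simp)
      (measurable_const.sub (monotone_cdf μ).measurable).aestronglyMeasurable ?_
    filter_upwards with x
    have := cdf_le_one μ x
    have := cdf_nonneg μ x
    rw [Real.norm_eq_abs, abs_le]
    constructor <;> linarith
  refine this.congr (Filter.Eventually.of_forall fun x => ?_)
  simp only [ENNReal.toReal_ofReal (h.density_nonneg x)]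
  by_cases hx : x ∈ Icc lo hi
  · simp only [hx, indicator_of_mem]
    rw [← h.density_mul_invHazard hx, mul_comm]
  · simp [hx, h.zero_off x hx]

/-- Integration by parts against the prior. -/
lemma integral_eq_add_integral_deriv_mul_invHazard (h : IsPrior lo hi μ f) {U : ℝ → ℝ}
    (hU : AbsolutelyContinuousOnInterval U lo hi) :
    ∫ x, U x ∂μ = U lo + ∫ x, deriv U x * invHazard μ f x ∂μ := by
  have hprob := h.prob
  have hle := h.lo_lt_hi.le
  -- The primitive of `f` is absolutely continuous and equals the cdf on `[lo, hi]`, so integration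
  -- by parts for absolutely continuous functions applies.
  set G : ℝ → ℝ := fun x => ∫ t in lo..x, f t with hG
  have hGac : AbsolutelyContinuousOnInterval G lo hi :=
    h.intervalIntegrable_density.absolutelyContinuousOnInterval_intervalIntegral (by simp)
  have hparts := hU.integral_mul_deriv_eq_deriv_mul hGac
  have hftc := hU.integral_deriv_eq_sub
  have hGhi : G hi = 1 := by
    rw [← h.cdf_hi, h.cdf_eq_integral (right_mem_Icc.2 hle)]
  have hGlo : G lo = 0 := by simp [hG]
  have h1 : ∫ x, U x ∂μ = ∫ x in lo..hi, U x * deriv G x := by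
    rw [h.integral_eq]
    apply intervalIntegral.integral_congr_ae
    filter_upwards [h.intervalIntegrable_density.ae_hasDerivAt_integral] with x hx hx'
    rw [(hx (uIoc_subset_uIcc hx') lo (by simp)).deriv, mul_comm]
  have h2 : ∫ x, deriv U x * invHazard μ f x ∂μ
      = ∫ x in lo..hi, (deriv U x - deriv U x * G x) := by
    rw [h.integral_eq]
    apply intervalIntegral.integral_congr
    intro x hx
    rw [uIcc_of_le hle] at hx
    have := h.density_mul_invHazard hx
    rw [h.cdf_eq_integral hx] at this
    simp only [hG]
    linear_combination deriv U x * this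
  -- The boundary term is `U hi`, and `U hi = U lo + ∫ U'` turns `-∫ U' G` into `∫ U' (1 - G)`.
  rw [h1, h2, hparts, intervalIntegral.integral_sub hU.intervalIntegrable_deriv
    (hU.intervalIntegrable_deriv.mul_continuousOn hGac.continuousOn), hftc, hGhi, hGlo]
  ring

lemma virtualValue_continuousWithinAt (h : IsPrior lo hi μ f) {c : ℝ} (hc : c ∈ Ico lo hi) :
    ContinuousWithinAt (virtualValue μ f) (Icc c hi) c := by
  refine continuousWithinAt_id.sub (ContinuousWithinAt.div ?_ ?_ (h.pos c hc).ne')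
  · exact continuousWithinAt_const.sub
      (((cdf μ).right_continuous c).mono Icc_subset_Ici_self)
  · exact (h.cont c (Ico_subset_Icc_self hc)).mono (Icc_subset_Icc_left hc.1)

lemma hi_mem_thresholdSet (h : IsPrior lo hi μ f) {x : ℝ} (hx : x ≤ hi) :
    hi ∈ thresholdSet lo hi μ f x := by
  have h0 := h.lo_nonneg
  have h1 := h.lo_lt_hi
  refine ⟨right_mem_Icc.2 h1.le, hx, ?_⟩
  rw [h.virtualValue_hi]; linarith

lemma bddBelow_thresholdSet (lo hi : ℝ) (μ : Measure ℝ) (f : ℝ → ℝ) (x : ℝ) :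
    BddBelow (thresholdSet lo hi μ f x) := ⟨lo, fun _ ha => ha.1.1⟩

/-- If the infimum `c < hi` violated `x ≤ c + ψ(c)`, right continuity would extend the violation to
an interval to the right of `c`, where feasible points must lie. -/
lemma isLeast_threshold (h : IsPrior lo hi μ f) {x : ℝ} (hx : x ∈ Icc lo hi) :
    IsLeast (thresholdSet lo hi μ f x) (threshold lo hi μ f x) := by
  have hne : (thresholdSet lo hi μ f x).Nonempty := ⟨hi, h.hi_mem_thresholdSet hx.2⟩
  have hbdd := bddBelow_thresholdSet lo hi μ f x
  refine ⟨?_, fun a ha => csInf_le hbdd ha⟩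
  set c := threshold lo hi μ f x with hc
  have hchi : c ≤ hi := csInf_le hbdd (h.hi_mem_thresholdSet hx.2)
  have hlc : lo ≤ c := le_csInf hne fun a ha => ha.1.1
  have hxc : x ≤ c := le_csInf hne fun a ha => ha.2.1
  rcases hchi.eq_or_lt with heq | hlt
  · rw [heq]; exact h.hi_mem_thresholdSet hx.2
  refine ⟨⟨hlc, hchi⟩, hxc, ?_⟩
  by_contra! hcon
  have hcont : ContinuousWithinAt (fun a => a + virtualValue μ f a) (Icc c hi) c :=
    continuousWithinAt_id.add (h.virtualValue_continuousWithinAt ⟨hlc, hlt⟩)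
  have hev := hcont.eventually_lt_const hcon
  rw [eventually_nhdsWithin_iff, Metric.eventually_nhds_iff] at hev
  obtain ⟨ε, hε, hball⟩ := hev
  obtain ⟨a, ha, hac⟩ := exists_lt_of_csInf_lt hne (lt_add_of_pos_right c hε)
  have hca : c ≤ a := csInf_le hbdd ha
  have := hball (y := a) (by rw [Real.dist_eq, abs_lt]; constructor <;> linarith) ⟨hca, ha.1.2⟩
  exact absurd ha.2.2 (not_le.2 this)

/-- Since `a + ψ(a)` is monotone, the feasible set is closed upwards in `[lo, hi]`. -/
lemma threshold_le_iff (h : IsPrior lo hi μ f) (hψ : MonotoneOn (virtualValue μ f) (Icc lo hi))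
    {x a : ℝ} (hx : x ∈ Icc lo hi) (ha : a ∈ Icc lo hi) (hxa : x ≤ a) :
    threshold lo hi μ f x ≤ a ↔ 0 ≤ virtualValue μ f a + a - x := by
  obtain ⟨hmem, hlb⟩ := h.isLeast_threshold hx
  constructor
  · intro hle
    have := hψ hmem.1 ha hle
    have := hmem.2.2
    linarith
  · intro h0
    exact hlb ⟨ha, hxa, by linarith⟩

lemma threshold_eq_self (h : IsPrior lo hi μ f) {x : ℝ} (hx : x ∈ Icc lo hi)
    (h0 : 0 ≤ virtualValue μ f x) : threshold lo hi μ f x = x :=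
  le_antisymm ((h.isLeast_threshold hx).2 ⟨hx, le_rfl, by linarith⟩)
    (h.isLeast_threshold hx).1.2.1

lemma lt_threshold (h : IsPrior lo hi μ f) {x : ℝ} (hx : x ∈ Icc lo hi)
    (h0 : virtualValue μ f x < 0) : x < threshold lo hi μ f x := by
  obtain ⟨-, h1, h2⟩ := (h.isLeast_threshold hx).1
  refine lt_of_le_of_ne h1 fun heq => ?_
  rw [← heq] at h2
  linarith

/-- Only `x = lo = 0` needs an argument: there `ψ(0) = -1 / f(0) < 0`. -/
lemma pos_of_virtualValue_nonneg (h : IsPrior lo hi μ f) {x : ℝ} (hx : x ∈ Icc lo hi)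
    (h0 : 0 ≤ virtualValue μ f x) : 0 < x := by
  refine (h.lo_nonneg.trans hx.1).lt_of_ne fun heq => ?_
  have hlo : lo = 0 := le_antisymm (hx.1.trans heq.ge) h.lo_nonneg
  subst hlo
  subst heq
  have := h.pos 0 ⟨le_rfl, h.lo_lt_hi⟩
  have h1 : virtualValue μ f 0 = -(f 0)⁻¹ := by simp [virtualValue, h.cdf_lo]
  rw [h1] at h0
  have := inv_pos.2 this
  linarith

/-- The feasible sets shrink as `x` grows, so the threshold is monotone up to `hi`. Beyond `hi` they
are empty and `sInf ∅ = 0` breaks monotonicity, hence the split. -/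
lemma measurable_threshold (h : IsPrior lo hi μ f) : Measurable (threshold lo hi μ f) := by
  classical
  have hmono : MonotoneOn (threshold lo hi μ f) (Iic hi) := by
    intro x _ y hy hxy
    exact csInf_le_csInf (bddBelow_thresholdSet lo hi μ f x) ⟨hi, h.hi_mem_thresholdSet hy⟩
      fun a ha => ⟨ha.1, hxy.trans ha.2.1, hxy.trans ha.2.2⟩
  have h0 : ∀ x ∉ Iic hi, threshold lo hi μ f x = 0 := by
    intro x hx
    have : thresholdSet lo hi μ f x = ∅ := by
      ext a
      simp only [thresholdSet, mem_ofPred_eq, mem_empty_iff_false, iff_false]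
      rintro ⟨ha, hxa, -⟩
      exact hx (hxa.trans ha.2)
    rw [threshold, this, Real.sInf_empty]
  refine measurable_of_restrict_of_restrict_compl (measurableSet_Iic (a := hi)) ?_ ?_
  · exact Monotone.measurable fun x y hxy => hmono x.2 y.2 hxy
  · have : (Iic hi)ᶜ.domRestrict (threshold lo hi μ f) = fun _ => 0 := by
      ext x; exact h0 x.1 x.2
    rw [this]; exact measurable_const

end IsPrior

/-! ### The joint law: redrawing a coordinate, absence of ties. -/

namespace IsPrior

variable {lo hi : ℝ} {μ : Measure ℝ} {f : ℝ → ℝ} {N : ℕ}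

lemma isProbabilityMeasure_jointLaw (h : IsPrior lo hi μ f) :
    IsProbabilityMeasure (jointLaw N μ) := by
  have := h.prob
  unfold jointLaw; infer_instance

/-- Redrawing one coordinate from the prior preserves the joint law. -/
lemma measurePreserving_update (h : IsPrior lo hi μ f) (i : Fin N) :
    MeasurePreserving (fun p : ℝ × (Fin N → ℝ) => Function.update p.2 i p.1)
      (μ.prod (jointLaw N μ)) (jointLaw N μ) := by
  classical
  have := h.prob
  have := h.isProbabilityMeasure_jointLaw (N := N)
  have hmeas : Measurable fun p : ℝ × (Fin N → ℝ) => Function.update p.2 i p.1 := by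
    refine measurable_pi_iff.2 fun j => ?_
    by_cases hj : j = i
    · subst hj; simpa using measurable_fst
    · simp only [Function.update_of_ne hj]
      exact (measurable_pi_apply j).comp measurable_snd
  refine ⟨hmeas, ?_⟩
  refine (Measure.pi_eq fun s hs => ?_).symm
  rw [Measure.map_apply hmeas (MeasurableSet.univ_pi hs)]
  -- The preimage of a box is a box: the redrawn value must lie in `s i`, and the old `i`-th
  -- coordinate is free, contributing the factor `1`.
  have hpre : (fun p : ℝ × (Fin N → ℝ) => Function.update p.2 i p.1) ⁻¹' univ.pi s
      = s i ×ˢ univ.pi (Function.update s i univ) := by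
    ext ⟨a, y⟩
    simp only [mem_preimage, mem_pi, mem_univ, true_implies, mem_prod]
    constructor
    · intro H
      refine ⟨by simpa using H i, fun j => ?_⟩
      by_cases hj : j = i
      · subst hj; simp
      · simpa [Function.update_of_ne hj] using H j
    · rintro ⟨H1, H2⟩ j
      by_cases hj : j = i
      · subst hj; simpa using H1
      · simpa [Function.update_of_ne hj] using H2 j
  rw [hpre, Measure.prod_prod, jointLaw, Measure.pi_pi,
    ← Finset.mul_prod_erase _ (fun j => μ (s j)) (Finset.mem_univ i),
    ← Finset.mul_prod_erase _ (fun j => μ (Function.update s i univ j)) (Finset.mem_univ i)]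
  simp only [Function.update_self, measure_univ, one_mul]
  congr 1
  refine Finset.prod_congr rfl fun j hj => ?_
  rw [Function.update_of_ne (Finset.ne_of_mem_erase hj)]

lemma measurePreserving_eval (h : IsPrior lo hi μ f) (i : Fin N) :
    MeasurePreserving (fun y : Fin N → ℝ => y i) (jointLaw N μ) μ := by
  have := h.prob
  exact MeasureTheory.measurePreserving_eval (fun _ => μ) i

lemma integrable_comp_update (h : IsPrior lo hi μ f) (i : Fin N) {F : (Fin N → ℝ) → ℝ}
    (hF : Integrable F (jointLaw N μ)) :
    Integrable (fun p : ℝ × (Fin N → ℝ) => F (Function.update p.2 i p.1))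
      (μ.prod (jointLaw N μ)) :=
  (h.measurePreserving_update i).integrable_comp_of_integrable hF

lemma integral_update (h : IsPrior lo hi μ f) (i : Fin N) {F : (Fin N → ℝ) → ℝ}
    (hF : Integrable F (jointLaw N μ)) :
    ∫ x, F x ∂(jointLaw N μ) = ∫ s, ∫ y, F (Function.update y i s) ∂(jointLaw N μ) ∂μ := by
  have := h.prob
  have := h.isProbabilityMeasure_jointLaw (N := N)
  have hmp := h.measurePreserving_update (N := N) i
  rw [← integral_prod _ (h.integrable_comp_update i hF)]
  conv_lhs => rw [← hmp.map_eq]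
  exact integral_map hmp.measurable.aemeasurable (by rw [hmp.map_eq]; exact hF.1)

lemma ae_mem (h : IsPrior lo hi μ f) : ∀ᵐ y ∂(jointLaw N μ), ∀ i, y i ∈ Ioo lo hi := by
  rw [ae_all_iff]
  exact fun i => (h.measurePreserving_eval i).quasiMeasurePreserving.ae h.ae_mem_Ioo

lemma ae_ne_const (h : IsPrior lo hi μ f) (q : ℝ) : ∀ᵐ y ∂(jointLaw N μ), ∀ i, y i ≠ q := by
  have := h.nullSingletonClass
  rw [ae_all_iff]
  intro i
  exact (h.measurePreserving_eval i).quasiMeasurePreserving.ae (p := fun x => x ≠ q)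
    (by rw [ae_iff]; simp only [ne_eq, not_not]; exact measure_singleton q)

/-- After redrawing coordinate `i`, Fubini reduces a tie to `y j` hitting a fixed value, which is
null for an atomless prior. -/
lemma ae_injective (h : IsPrior lo hi μ f) :
    ∀ᵐ y ∂(jointLaw N μ), Function.Injective y := by
  have := h.prob
  have := h.isProbabilityMeasure_jointLaw (N := N)
  have key : ∀ i j : Fin N, i ≠ j → ∀ᵐ y ∂(jointLaw N μ), y i ≠ y j := by
    intro i j hij
    have hmp := h.measurePreserving_update (N := N) i
    have hms : MeasurableSet {y : Fin N → ℝ | y i ≠ y j} :=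
      (measurableSet_eq_fun (measurable_pi_apply i) (measurable_pi_apply j)).compl
    rw [← hmp.map_eq, ae_map_iff hmp.measurable.aemeasurable hms]
    refine (Measure.ae_prod_iff_ae_ae (hmp.measurable hms)).2 ?_
    refine Filter.Eventually.of_forall fun s => ?_
    filter_upwards [h.ae_ne_const s] with y hy
    simpa [Function.update_of_ne hij.symm] using (hy j).symm
  have : ∀ᵐ y ∂(jointLaw N μ), ∀ i j : Fin N, i ≠ j → y i ≠ y j := by
    simp only [ae_all_iff]
    exact key
  filter_upwards [this] with y hy i j hij
  by_contra hne
  exact hy i j hne hij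

/-- Almost surely, the rivals' reports are interior and there are no ties, not even with `q`. -/
lemma ae_generic (h : IsPrior lo hi μ f) (q : ℝ) : ∀ᵐ y ∂(jointLaw N μ),
    (∀ i, y i ∈ Ioo lo hi) ∧ Function.Injective y ∧ ∀ i, y i ≠ q := by
  filter_upwards [h.ae_mem, h.ae_injective, h.ae_ne_const q] with y a b c using ⟨a, b, c⟩

end IsPrior

lemma update_injective {N : ℕ} {y : Fin N → ℝ} {i : Fin N} {q : ℝ} (hy : Function.Injective y)
    (hq : ∀ j, y j ≠ q) : Function.Injective (Function.update y i q) := by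
  intro a b hab
  by_cases ha : a = i <;> by_cases hb : b = i
  · rw [ha, hb]
  · subst ha
    rw [Function.update_self, Function.update_of_ne hb] at hab
    exact absurd hab.symm (hq b)
  · subst hb
    rw [Function.update_self, Function.update_of_ne ha] at hab
    exact absurd hab (hq a)
  · rw [Function.update_of_ne ha, Function.update_of_ne hb] at hab
    exact hy hab

lemma update_mem {N : ℕ} {y : Fin N → ℝ} {i : Fin N} {q lo hi : ℝ} (hy : ∀ j, y j ∈ Ioo lo hi)
    (hq : q ∈ Icc lo hi) (j : Fin N) : Function.update y i q j ∈ Icc lo hi := by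
  by_cases hj : j = i
  · subst hj; simpa using hq
  · rw [Function.update_of_ne hj]; exact Ioo_subset_Icc_self (hy j)

/-! ### Gross payoffs as functions of the own valuation. -/

section Payoffs

variable {N : ℕ}

lemma fold_max_eq {v : Fin N → ℝ} {S : Finset (Fin N)} {m : Fin N} (hm : m ∈ S)
    (h0 : 0 ≤ v m) (hle : ∀ k ∈ S, v k ≤ v m) : S.fold max 0 v = v m :=
  le_antisymm ((Finset.fold_max_le _).2 ⟨h0, hle⟩) ((Finset.le_fold_max _).2 (Or.inr ⟨m, hm, le_rfl⟩))

/-- Positivity of `s` matters because the fold starts from `0`, which can itself be the maximum. -/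
lemma fold_max_ne {v : Fin N → ℝ} {S : Finset (Fin N)} {s : ℝ} (hs : 0 < s)
    (hv : ∀ k ∈ S, v k ≠ s) : S.fold max 0 v ≠ s := by
  intro heq
  rcases (Finset.le_fold_max _).1 heq.ge with h | ⟨k, hk, h⟩
  · linarith
  · exact hv k hk (le_antisymm (((Finset.fold_max_le _).1 heq.le).2 k hk) h)

lemma fold_max_nonneg (v : Fin N → ℝ) (S : Finset (Fin N)) : 0 ≤ S.fold max 0 v :=
  (Finset.le_fold_max _).2 (Or.inl le_rfl)

lemma measurable_fold_max (S : Finset (Fin N)) :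
    Measurable fun v : Fin N → ℝ => S.fold max 0 v := by
  induction S using Finset.induction_on with
  | empty => simp
  | insert a S ha ih =>
    simp only [Finset.fold_insert ha]
    exact (measurable_pi_apply a).max ih

lemma fold_max_update {y : Fin N → ℝ} {i : Fin N} {S : Finset (Fin N)} (hi : i ∉ S) (x : ℝ) :
    S.fold max 0 (Function.update y i x) = S.fold max 0 y :=
  Finset.fold_congr fun _ hk => Function.update_of_ne (ne_of_mem_of_not_mem hk hi) _ _

/-- The derivative of `secondAuctionPayoff` in the own valuation. -/
def secondAuctionSlope (v : Fin N → ℝ) (S : Finset (Fin N)) (i : Fin N) : ℝ :=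
  if S.fold max 0 v < v i then 1 else 0

lemma measurable_secondAuctionPayoff (S : Finset (Fin N)) (i : Fin N) :
    Measurable fun v => secondAuctionPayoff v S i :=
  ((measurable_pi_apply i).sub (measurable_fold_max S)).max measurable_const

lemma measurable_secondAuctionSlope (S : Finset (Fin N)) (i : Fin N) :
    Measurable fun v => secondAuctionSlope v S i :=
  Measurable.ite (measurableSet_lt (measurable_fold_max S) (measurable_pi_apply i))
    measurable_const measurable_const

lemma abs_secondAuctionPayoff_le {v : Fin N → ℝ} {S : Finset (Fin N)} {i : Fin N} {c : ℝ}
    (h0 : 0 ≤ v i) (hc : v i ≤ c) : |secondAuctionPayoff v S i| ≤ c := by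
  have := fold_max_nonneg v S
  rw [secondAuctionPayoff, abs_of_nonneg (le_max_right _ _)]
  exact max_le (by linarith) (by linarith)

lemma abs_secondAuctionSlope_le (v : Fin N → ℝ) (S : Finset (Fin N)) (i : Fin N) :
    |secondAuctionSlope v S i| ≤ 1 := by
  rw [secondAuctionSlope]; split_ifs <;> simp

lemma abs_secondAuctionPayoff_update_sub_le (y : Fin N → ℝ) {S : Finset (Fin N)} {i : Fin N}
    (hi : i ∉ S) (x x' : ℝ) :
    |secondAuctionPayoff (Function.update y i x) S i
      - secondAuctionPayoff (Function.update y i x') S i| ≤ |x - x'| := by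
  simp only [secondAuctionPayoff, fold_max_update hi, Function.update_self]
  refine (abs_max_sub_max_le_abs _ _ _).trans (le_of_eq ?_)
  congr 1; ring

/-- The only kink is at the highest rival valuation, or at `0` if there is no rival; the hypotheses
keep `s` away from both. -/
lemma hasDerivAt_secondAuctionPayoff {y : Fin N → ℝ} {S : Finset (Fin N)} {i : Fin N}
    (hi : i ∉ S) {s : ℝ} (hs : 0 < s) (hy : ∀ k, y k ≠ s) :
    HasDerivAt (fun x => secondAuctionPayoff (Function.update y i x) S i)
      (secondAuctionSlope (Function.update y i s) S i) s := by
  simp only [secondAuctionPayoff, secondAuctionSlope, fold_max_update hi, Function.update_self]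
  rcases lt_or_gt_of_ne (fold_max_ne hs fun k (_ : k ∈ S) => hy k) with hlt | hgt
  · rw [if_pos hlt]
    refine ((hasDerivAt_id s).sub_const (S.fold max 0 y)).congr_of_eventuallyEq ?_
    filter_upwards [lt_mem_nhds hlt] with x hx
    exact max_eq_left (sub_nonneg.2 hx.le)
  · rw [if_neg hgt.le.not_gt]
    refine (hasDerivAt_const s (0 : ℝ)).congr_of_eventuallyEq ?_
    filter_upwards [gt_mem_nhds hgt] with x hx
    exact max_eq_right (sub_nonpos.2 hx.le)

namespace DirectMechanism

/-- The allocation probabilities at the reports `b` are feasible. -/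
def FeasibleAt (M : DirectMechanism N) (b : Fin N → ℝ) : Prop :=
  (∀ i, 0 ≤ M.alloc b i) ∧ ∑ i, M.alloc b i ≤ 1

/-- The average, over the allocation of the good, of `own` if `i` gets it and of `p S` if `i` meets
the set `S` of rivals in the second auction. -/
def average (M : DirectMechanism N) (b : Fin N → ℝ) (i : Fin N) (own : ℝ)
    (p : Finset (Fin N) → ℝ) : ℝ :=
  M.alloc b i * own
    + ∑ j ∈ Finset.univ.erase i, M.alloc b j * p ((Finset.univ.erase i).erase j)
    + (1 - ∑ j, M.alloc b j) * p (Finset.univ.erase i)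

lemma grossPayoff_eq_average (M : DirectMechanism N) (v b : Fin N → ℝ) (i : Fin N) :
    M.grossPayoff v b i = M.average b i (v i) fun S => secondAuctionPayoff v S i := rfl

/-- Linearity, used with `c = 1` for the Lipschitz bound and with `c` the inverse hazard rate for
virtual surplus. -/
lemma average_sub_mul (M : DirectMechanism N) (b : Fin N → ℝ) (i : Fin N) (a a' c : ℝ)
    (p p' : Finset (Fin N) → ℝ) :
    M.average b i (a - c * a') (fun S => p S - c * p' S)
      = M.average b i a p - c * M.average b i a' p' := by
  simp only [average, mul_sub, Finset.sum_sub_distrib, mul_add, Finset.mul_sum]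
  have : ∀ j, M.alloc b j * (c * p' ((Finset.univ.erase i).erase j))
      = c * (M.alloc b j * p' ((Finset.univ.erase i).erase j)) := fun j => by ring
  simp only [this]
  ring

/-- Feasible allocation probabilities make `average` a convex combination. -/
lemma abs_average_le {M : DirectMechanism N} {b : Fin N → ℝ} (hb : M.FeasibleAt b) (i : Fin N)
    {a c : ℝ} {p : Finset (Fin N) → ℝ} (ha : |a| ≤ c) (hp : ∀ S, i ∉ S → |p S| ≤ c) :
    |M.average b i a p| ≤ c := by
  have hnn := hb.1
  have hsum := Finset.add_sum_erase Finset.univ (M.alloc b) (Finset.mem_univ i)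
  have h1 : |M.alloc b i * a| ≤ M.alloc b i * c := by
    rw [abs_mul, abs_of_nonneg (hnn i)]
    exact mul_le_mul_of_nonneg_left ha (hnn i)
  have h2 : |∑ j ∈ Finset.univ.erase i, M.alloc b j * p ((Finset.univ.erase i).erase j)|
      ≤ (∑ j ∈ Finset.univ.erase i, M.alloc b j) * c := by
    rw [Finset.sum_mul]
    refine (Finset.abs_sum_le_sum_abs _ _).trans (Finset.sum_le_sum fun j _ => ?_)
    rw [abs_mul, abs_of_nonneg (hnn j)]
    exact mul_le_mul_of_nonneg_left (hp _ (by simp)) (hnn j)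
  have h3 : |(1 - ∑ j, M.alloc b j) * p (Finset.univ.erase i)| ≤ (1 - ∑ j, M.alloc b j) * c := by
    have := sub_nonneg.2 hb.2
    rw [abs_mul, abs_of_nonneg this]
    exact mul_le_mul_of_nonneg_left (hp _ (by simp)) this
  refine ((abs_add_le _ _).trans (add_le_add ((abs_add_le _ _).trans (add_le_add h1 h2)) h3)).trans
    (le_of_eq ?_)
  rw [← hsum]; ring

/-- The derivative of the gross payoff in the own valuation. -/
def grossSlope (M : DirectMechanism N) (v b : Fin N → ℝ) (i : Fin N) : ℝ :=
  M.average b i 1 fun S => secondAuctionSlope v S i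

lemma abs_grossPayoff_le {M : DirectMechanism N} {v b : Fin N → ℝ} (hb : M.FeasibleAt b)
    {i : Fin N} {c : ℝ} (h0 : 0 ≤ v i) (hc : v i ≤ c) : |M.grossPayoff v b i| ≤ c := by
  rw [grossPayoff_eq_average]
  exact abs_average_le hb i (by rwa [abs_of_nonneg h0]) fun _ _ => abs_secondAuctionPayoff_le h0 hc

lemma abs_grossSlope_le {M : DirectMechanism N} {v b : Fin N → ℝ} (hb : M.FeasibleAt b)
    (i : Fin N) : |M.grossSlope v b i| ≤ 1 := by
  rw [grossSlope]
  exact abs_average_le hb i (by simp) fun _ _ => abs_secondAuctionSlope_le _ _ _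

lemma abs_grossPayoff_update_sub_le {M : DirectMechanism N} {b : Fin N → ℝ}
    (hb : M.FeasibleAt b) (y : Fin N → ℝ) (i : Fin N) (x x' : ℝ) :
    |M.grossPayoff (Function.update y i x) b i - M.grossPayoff (Function.update y i x') b i|
      ≤ |x - x'| := by
  have := M.average_sub_mul b i x x' 1
    (fun S => secondAuctionPayoff (Function.update y i x) S i)
    (fun S => secondAuctionPayoff (Function.update y i x') S i)
  simp only [one_mul] at this
  rw [grossPayoff_eq_average, grossPayoff_eq_average, Function.update_self, Function.update_self,
    ← this]
  exact abs_average_le hb i le_rfl fun S hS => abs_secondAuctionPayoff_update_sub_le y hS x x'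

lemma hasDerivAt_grossPayoff (M : DirectMechanism N) (b : Fin N → ℝ) {y : Fin N → ℝ} (i : Fin N)
    {s : ℝ} (hs : 0 < s) (hy : ∀ k, y k ≠ s) :
    HasDerivAt (fun x => M.grossPayoff (Function.update y i x) b i)
      (M.grossSlope (Function.update y i s) b i) s := by
  simp only [grossPayoff_eq_average, grossSlope, average, Function.update_self]
  refine HasDerivAt.add (HasDerivAt.add ?_ ?_) ?_
  · exact (hasDerivAt_id s).const_mul _
  · exact HasDerivAt.fun_sum fun j _ =>
      (hasDerivAt_secondAuctionPayoff (by simp) hs hy).const_mul _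
  · exact (hasDerivAt_secondAuctionPayoff (by simp) hs hy).const_mul _

lemma measurable_average {M : DirectMechanism N} (hM : ∀ i, Measurable fun x => M.alloc x i)
    {α : Type*} [MeasurableSpace α] {b : α → Fin N → ℝ} (hb : Measurable b) (i : Fin N)
    {a : α → ℝ} (ha : Measurable a) {p : α → Finset (Fin N) → ℝ}
    (hp : ∀ S, Measurable fun x => p x S) :
    Measurable fun x => M.average (b x) i (a x) (p x) := by
  have hal : ∀ i, Measurable fun x => M.alloc (b x) i := fun i => (hM i).comp hb
  unfold average
  refine Measurable.add (Measurable.add ((hal i).mul ha) ?_) ?_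
  · exact Finset.measurable_fun_sum _ fun j _ => (hal j).mul (hp _)
  · exact (measurable_const.sub (Finset.measurable_fun_sum _ fun j _ => hal j)).mul (hp _)

lemma measurable_grossPayoff {M : DirectMechanism N} (hM : ∀ i, Measurable fun x => M.alloc x i)
    {α : Type*} [MeasurableSpace α] {v b : α → Fin N → ℝ} (hv : Measurable v) (hb : Measurable b)
    (i : Fin N) : Measurable fun x => M.grossPayoff (v x) (b x) i :=
  measurable_average hM hb i ((measurable_pi_apply i).comp hv)
    fun S => (measurable_secondAuctionPayoff S i).comp hv

lemma measurable_grossSlope {M : DirectMechanism N} (hM : ∀ i, Measurable fun x => M.alloc x i)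
    {α : Type*} [MeasurableSpace α] {v b : α → Fin N → ℝ} (hv : Measurable v) (hb : Measurable b)
    (i : Fin N) : Measurable fun x => M.grossSlope (v x) (b x) i :=
  measurable_average hM hb i measurable_const
    fun S => (measurable_secondAuctionSlope S i).comp hv

end DirectMechanism

end Payoffs

variable {N : ℕ} {lo hi : ℝ} {μ : Measure ℝ} {f : ℝ → ℝ}

/-! ### The envelope theorem and the revenue identity. -/

namespace DirectMechanism

/-- Interim expected gross payoff of buyer `i` with valuation `x` who reports `q`. -/
def interimGross (M : DirectMechanism N) (μ : Measure ℝ) (i : Fin N) (q x : ℝ) : ℝ :=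
  ∫ y, M.grossPayoff (Function.update y i x) (Function.update y i q) i ∂(jointLaw N μ)

/-- The derivative of `interimGross` in the own valuation. -/
def interimSlope (M : DirectMechanism N) (μ : Measure ℝ) (i : Fin N) (q x : ℝ) : ℝ :=
  ∫ y, M.grossSlope (Function.update y i x) (Function.update y i q) i ∂(jointLaw N μ)

/-- Buyer `i`'s contribution to the virtual surplus under truthful reports. -/
def virtualSurplus (M : DirectMechanism N) (μ : Measure ℝ) (f : ℝ → ℝ) (x : Fin N → ℝ)
    (i : Fin N) : ℝ :=
  M.grossPayoff x x i - invHazard μ f (x i) * M.grossSlope x x i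

lemma integrable_grossPayoff_update {M : DirectMechanism N}
    (hmeas : ∀ i, Measurable fun x => M.alloc x i)
    (hfeas : ∀ b : Fin N → ℝ, (∀ i, b i ∈ Icc lo hi) → M.FeasibleAt b) (h : IsPrior lo hi μ f)
    (i : Fin N) {q x : ℝ} (hq : q ∈ Icc lo hi) (hx : x ∈ Icc lo hi) :
    Integrable (fun y => M.grossPayoff (Function.update y i x) (Function.update y i q) i)
      (jointLaw N μ) := by
  have := h.isProbabilityMeasure_jointLaw (N := N)
  refine Integrable.of_bound (measurable_grossPayoff hmeas measurable_update_left
    measurable_update_left i).aestronglyMeasurable hi ?_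
  filter_upwards [h.ae_mem] with y hy
  exact abs_grossPayoff_le (hfeas _ (update_mem hy hq)) (by simpa using h.lo_nonneg.trans hx.1)
    (by simpa using hx.2)

namespace IsAdmissible

variable {M : DirectMechanism N}

lemma feasibleAt (hM : M.IsAdmissible lo hi μ) {b : Fin N → ℝ} (hb : ∀ i, b i ∈ Icc lo hi) :
    M.FeasibleAt b := ⟨hM.alloc_nonneg b hb, hM.alloc_sum_le_one b hb⟩

lemma ae_feasibleAt_update (hM : M.IsAdmissible lo hi μ) (h : IsPrior lo hi μ f) (i : Fin N)
    {q : ℝ} (hq : q ∈ Icc lo hi) :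
    ∀ᵐ y ∂(jointLaw N μ), M.FeasibleAt (Function.update y i q) := by
  filter_upwards [h.ae_mem] with y hy
  exact hM.feasibleAt (update_mem hy hq)

lemma integrable_grossPayoff_update (hM : M.IsAdmissible lo hi μ) (h : IsPrior lo hi μ f)
    (i : Fin N) {q x : ℝ} (hq : q ∈ Icc lo hi) (hx : x ∈ Icc lo hi) :
    Integrable (fun y => M.grossPayoff (Function.update y i x) (Function.update y i q) i)
      (jointLaw N μ) :=
  DirectMechanism.integrable_grossPayoff_update hM.measurable_alloc
    (fun _ hb => hM.feasibleAt hb) h i hq hx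

lemma interimPayoff_eq (hM : M.IsAdmissible lo hi μ) (h : IsPrior lo hi μ f)
    (i : Fin N) {q x : ℝ} (hq : q ∈ Icc lo hi) (hx : x ∈ Icc lo hi) :
    M.interimPayoff μ i q x = M.interimGross μ i q x
      - ∫ y, M.pay (Function.update y i q) i ∂(jointLaw N μ) :=
  integral_sub (hM.integrable_grossPayoff_update h i hq hx) (hM.integrable_interim_pay i q hq)

lemma abs_interimGross_sub_le (hM : M.IsAdmissible lo hi μ) (h : IsPrior lo hi μ f)
    (i : Fin N) {q x x' : ℝ} (hq : q ∈ Icc lo hi) (hx : x ∈ Icc lo hi) (hx' : x' ∈ Icc lo hi) :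
    |M.interimGross μ i q x - M.interimGross μ i q x'| ≤ |x - x'| := by
  have := h.isProbabilityMeasure_jointLaw (N := N)
  rw [interimGross, interimGross, ← integral_sub (hM.integrable_grossPayoff_update h i hq hx)
    (hM.integrable_grossPayoff_update h i hq hx'), ← Real.norm_eq_abs]
  refine (norm_integral_le_of_norm_le_const (C := |x - x'|) ?_).trans (by simp)
  filter_upwards [hM.ae_feasibleAt_update h i hq] with y hy
  exact abs_grossPayoff_update_sub_le hy y i x x'

lemma hasDerivAt_interimGross (hM : M.IsAdmissible lo hi μ) (h : IsPrior lo hi μ f)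
    (i : Fin N) {q s : ℝ} (hq : q ∈ Icc lo hi) (hs : s ∈ Ioo lo hi) :
    HasDerivAt (M.interimGross μ i q) (M.interimSlope μ i q s) s := by
  have := h.isProbabilityMeasure_jointLaw (N := N)
  refine (hasDerivAt_integral_of_dominated_loc_of_lip (s := univ) (bound := fun _ => 1)
    Filter.univ_mem ?_ (hM.integrable_grossPayoff_update h i hq (Ioo_subset_Icc_self hs)) ?_ ?_
    (integrable_const _) ?_).2
  · exact Filter.Eventually.of_forall fun x => (measurable_grossPayoff hM.measurable_alloc
      measurable_update_left measurable_update_left i).aestronglyMeasurable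
  · exact (measurable_grossSlope hM.measurable_alloc
      measurable_update_left measurable_update_left i).aestronglyMeasurable
  · filter_upwards [hM.ae_feasibleAt_update h i hq] with y hy
    refine LipschitzOnWith.of_dist_le_mul fun x _ x' _ => ?_
    simpa [Real.dist_eq] using abs_grossPayoff_update_sub_le hy y i x x'
  · filter_upwards [h.ae_ne_const s] with y hy
    exact M.hasDerivAt_grossPayoff _ i (h.lo_nonneg.trans_lt hs.1) hy

/-- Both sides concern the report `x'`, whose expected payment cancels. This is the form in which
incentive compatibility is used. -/
lemma interimGross_sub_le (hM : M.IsAdmissible lo hi μ) (h : IsPrior lo hi μ f)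
    (i : Fin N) {x x' : ℝ} (hx : x ∈ Icc lo hi) (hx' : x' ∈ Icc lo hi) :
    M.interimGross μ i x' x - M.interimGross μ i x' x'
      ≤ M.interimPayoff μ i x x - M.interimPayoff μ i x' x' := by
  have := hM.incentive_compatible i x hx x' hx'
  rw [hM.interimPayoff_eq h i hx' hx] at this
  rw [hM.interimPayoff_eq h i hx' hx']
  linarith

/-- Misreporting `x` at the true type `x'` loses at most `|x - x'|` in gross payoff, so the truthful
payoff is 1-Lipschitz. -/
lemma absolutelyContinuousOnInterval (hM : M.IsAdmissible lo hi μ) (h : IsPrior lo hi μ f)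
    (i : Fin N) : AbsolutelyContinuousOnInterval (fun x => M.interimPayoff μ i x x) lo hi := by
  refine LipschitzOnWith.absolutelyContinuousOnInterval (K := 1) ?_
  rw [uIcc_of_le h.lo_lt_hi.le]
  refine LipschitzOnWith.of_le_add_mul 1 fun x hx x' hx' => ?_
  have h1 := hM.interimGross_sub_le h i hx' hx
  have h2 := abs_le.1 (hM.abs_interimGross_sub_le h i hx hx' hx)
  rw [Real.dist_eq, NNReal.coe_one, one_mul, abs_sub_comm]
  linarith [h2.1]

/-- The envelope theorem: the slope of the truthful payoff. -/
lemma deriv_interimPayoff (hM : M.IsAdmissible lo hi μ) (h : IsPrior lo hi μ f)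
    (i : Fin N) {s : ℝ} (hs : s ∈ Ioo lo hi)
    (hd : DifferentiableAt ℝ (fun x => M.interimPayoff μ i x x) s) :
    deriv (fun x => M.interimPayoff μ i x x) s = M.interimSlope μ i s s := by
  have hs' := Ioo_subset_Icc_self hs
  have hd2 := hd.hasDerivAt.sub (hM.hasDerivAt_interimGross h i hs' hs)
  -- With the report frozen at `s`, truthful payoff minus gross payoff is smallest at type `s`, so
  -- its derivative vanishes there.
  have hmin : IsLocalMin ((fun x => M.interimPayoff μ i x x) - M.interimGross μ i s) s := by
    filter_upwards [Ioo_mem_nhds hs.1 hs.2] with x hx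
    have := hM.interimGross_sub_le h i (Ioo_subset_Icc_self hx) hs'
    simp only [Pi.sub_apply]
    linarith
  linarith [hmin.hasDerivAt_eq_zero hd2]

lemma integral_interimPayoff (hM : M.IsAdmissible lo hi μ) (h : IsPrior lo hi μ f) (i : Fin N) :
    ∫ x, M.interimPayoff μ i x x ∂μ = M.interimPayoff μ i lo lo
      + ∫ x, M.interimSlope μ i x x * invHazard μ f x ∂μ := by
  have hac := hM.absolutelyContinuousOnInterval h i
  rw [h.integral_eq_add_integral_deriv_mul_invHazard hac]
  congr 1
  refine integral_congr_ae ?_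
  -- Lebesgue-a.e. differentiability passes to the prior, which has a density.
  have hdiff : ∀ᵐ x ∂μ, x ∈ uIcc lo hi →
      DifferentiableAt ℝ (fun x => M.interimPayoff μ i x x) x := by
    have hac' : μ ≪ volume := by
      rw [h.eq_withDensity]; exact withDensity_absolutelyContinuous _ _
    exact hac'.ae_le hac.ae_differentiableAt
  filter_upwards [hdiff, h.ae_mem_Ioo] with x hx hx'
  rw [hM.deriv_interimPayoff h i hx' (hx (by
    rw [uIcc_of_le h.lo_lt_hi.le]; exact Ioo_subset_Icc_self hx'))]

lemma integrable_grossPayoff (hM : M.IsAdmissible lo hi μ) (h : IsPrior lo hi μ f) (i : Fin N) :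
    Integrable (fun x => M.grossPayoff x x i) (jointLaw N μ) := by
  have := h.isProbabilityMeasure_jointLaw (N := N)
  refine Integrable.of_bound (measurable_grossPayoff hM.measurable_alloc measurable_id
    measurable_id i).aestronglyMeasurable hi ?_
  filter_upwards [h.ae_mem] with y hy
  exact abs_grossPayoff_le (hM.feasibleAt fun j => Ioo_subset_Icc_self (hy j))
    (h.lo_nonneg.trans (hy i).1.le) (hy i).2.le

lemma integrable_invHazard_mul_grossSlope (hM : M.IsAdmissible lo hi μ) (h : IsPrior lo hi μ f)
    (i : Fin N) :
    Integrable (fun x => invHazard μ f (x i) * M.grossSlope x x i) (jointLaw N μ) := by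
  refine Integrable.mul_bdd (c := 1)
    ((h.measurePreserving_eval i).integrable_comp_of_integrable h.integrable_invHazard)
    (measurable_grossSlope hM.measurable_alloc measurable_id measurable_id i).aestronglyMeasurable
    ?_
  filter_upwards [h.ae_mem] with y hy
  exact abs_grossSlope_le (hM.feasibleAt fun j => Ioo_subset_Icc_self (hy j)) i

lemma integrable_virtualSurplus (hM : M.IsAdmissible lo hi μ) (h : IsPrior lo hi μ f)
    (i : Fin N) : Integrable (fun x => M.virtualSurplus μ f x i) (jointLaw N μ) :=
  (hM.integrable_grossPayoff h i).sub (hM.integrable_invHazard_mul_grossSlope h i)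

/-- Expected payments are the expected virtual surplus less the payoff of the lowest type. -/
lemma integral_pay (hM : M.IsAdmissible lo hi μ) (h : IsPrior lo hi μ f) (i : Fin N) :
    ∫ x, M.pay x i ∂(jointLaw N μ)
      = ∫ x, M.virtualSurplus μ f x i ∂(jointLaw N μ) - M.interimPayoff μ i lo lo := by
  have := h.prob
  have := h.isProbabilityMeasure_jointLaw (N := N)
  have hg := hM.integrable_grossPayoff h i
  have hs := hM.integrable_invHazard_mul_grossSlope h i
  have hp := hM.integrable_pay i
  have e1 : ∫ x, M.grossPayoff x x i - M.pay x i ∂(jointLaw N μ)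
      = ∫ x, M.interimPayoff μ i x x ∂μ := h.integral_update i (hg.sub hp)
  have e2 : ∫ x, invHazard μ f (x i) * M.grossSlope x x i ∂(jointLaw N μ)
      = ∫ x, M.interimSlope μ i x x * invHazard μ f x ∂μ := by
    rw [h.integral_update i hs]
    simp only [Function.update_self, integral_const_mul, interimSlope, mul_comm]
  rw [integral_sub hg hp, hM.integral_interimPayoff h i] at e1
  simp only [virtualSurplus]
  rw [integral_sub hg hs]
  linarith

end IsAdmissible

/-- The mechanism that never allocates the good. -/
def inactive (N : ℕ) : DirectMechanism N where
  alloc _ _ := 0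
  pay _ _ := 0

lemma interimPayoff_inactive (i : Fin N) (q x : ℝ) :
    (inactive N).interimPayoff μ i q x = outsideOption N μ i x := by
  simp [inactive, interimPayoff, outsideOption, grossPayoff]

/-- This is the benchmark: no payments, and individual rationality binds for every type. -/
lemma isAdmissible_inactive : (inactive N).IsAdmissible lo hi μ where
  measurable_alloc _ := measurable_const
  measurable_pay _ := measurable_const
  integrable_pay _ := integrable_zero _ _ _
  integrable_interim_pay _ _ _ := integrable_zero _ _ _
  alloc_nonneg _ _ _ := le_rfl
  alloc_sum_le_one _ _ := by simp [inactive]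
  incentive_compatible _ _ _ _ _ := by simp only [interimPayoff_inactive, le_refl]
  individually_rational _ _ _ := by simp only [interimPayoff_inactive, le_refl]

end DirectMechanism

/-! ### Rankings of the reports. -/

/-- The buyers `a`, `b`, `c` hold the three highest entries of `x`, in this order. -/
structure IsTopThree (x : Fin N → ℝ) (a b c : Fin N) : Prop where
  second_lt_first : x b < x a
  third_lt_second : x c < x b
  le_third : ∀ k, k ≠ a → k ≠ b → x k ≤ x c

namespace IsTopThree

variable {x : Fin N → ℝ} {a b c : Fin N}

lemma ne_first_second (ht : IsTopThree x a b c) : a ≠ b :=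
  fun e => ht.second_lt_first.ne (by rw [e])

lemma ne_second_third (ht : IsTopThree x a b c) : b ≠ c :=
  fun e => ht.third_lt_second.ne (by rw [e])

lemma ne_first_third (ht : IsTopThree x a b c) : a ≠ c :=
  fun e => (ht.third_lt_second.trans ht.second_lt_first).ne (by rw [e])

lemma le_second (ht : IsTopThree x a b c) (k : Fin N) (hk : k ≠ a) : x k ≤ x b := by
  by_cases hb : k = b
  · rw [hb]
  · exact (ht.le_third k hk hb).trans ht.third_lt_second.le

end IsTopThree

/-- The ranking that `orderStat` reads off. -/
def sortedRanking (x : Fin N → ℝ) : Equiv.Perm (Fin N) :=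
  Tuple.sort fun i => OrderDual.toDual (x i)

lemma orderStat_eq (x : Fin N → ℝ) (k : Fin N) : orderStat x k = x (sortedRanking x k) := rfl

lemma antitone_sortedRanking (x : Fin N → ℝ) : Antitone fun k => x (sortedRanking x k) :=
  fun _ _ h => OrderDual.toDual_le_toDual.1
    (Tuple.monotone_sort (fun i => OrderDual.toDual (x i)) h)

lemma mem_rankings {x : Fin N → ℝ} {σ : Equiv.Perm (Fin N)} :
    σ ∈ rankings x ↔ Antitone fun k => x (σ k) := by
  simp [rankings]

lemma eq_orderStat_of_antitone {x : Fin N → ℝ} {σ : Equiv.Perm (Fin N)}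
    (hσ : Antitone fun k => x (σ k)) (k : Fin N) : orderStat x k = x (σ k) :=
  (congrFun (Tuple.unique_antitone hσ (antitone_sortedRanking x)) k).symm

/-- Without ties the random tie-breaking is an average over one ranking; ties have probability zero.
-/
lemma rankings_eq_singleton {x : Fin N → ℝ} (hx : Function.Injective x) :
    rankings x = {sortedRanking x} := by
  ext σ
  rw [mem_rankings, Finset.mem_singleton]
  constructor
  · intro hσ
    ext k
    exact congrArg Fin.val (hx (eq_orderStat_of_antitone hσ k).symm)
  · rintro rfl
    exact antitone_sortedRanking x

section Fin

variable [NeZero N]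

lemma fin_one_ne_zero (hN : 3 ≤ N) : (1 : Fin N) ≠ 0 := by
  obtain ⟨n, rfl⟩ := Nat.exists_eq_add_of_le' hN
  simp

lemma fin_zero_lt_one (hN : 3 ≤ N) : (0 : Fin N) < 1 := by
  obtain ⟨n, rfl⟩ := Nat.exists_eq_add_of_le' hN
  simp

lemma fin_one_lt_two (hN : 3 ≤ N) : (1 : Fin N) < 2 := by
  obtain ⟨n, rfl⟩ := Nat.exists_eq_add_of_le' hN
  simp [Fin.lt_def, Nat.mod_eq_of_lt]

lemma fin_two_le (hN : 3 ≤ N) {k : Fin N} (h0 : k ≠ 0) (h1 : k ≠ 1) : 2 ≤ k := by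
  obtain ⟨n, rfl⟩ := Nat.exists_eq_add_of_le' hN
  have e0 : ((0 : Fin (n + 3)) : ℕ) = 0 := rfl
  have e1 : ((1 : Fin (n + 3)) : ℕ) = 1 := rfl
  have e2 : ((2 : Fin (n + 3)) : ℕ) = 2 := rfl
  rw [Ne, Fin.ext_iff] at h0 h1
  rw [Fin.le_def]
  omega

lemma isTopThree_sortedRanking (hN : 3 ≤ N) {x : Fin N → ℝ} (hx : Function.Injective x) :
    IsTopThree x (sortedRanking x 0) (sortedRanking x 1) (sortedRanking x 2) := by
  have hanti := antitone_sortedRanking x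
  have hinj : Function.Injective fun k => x (sortedRanking x k) :=
    hx.comp (sortedRanking x).injective
  have hs : StrictAnti fun k => x (sortedRanking x k) := hanti.strictAnti_of_injective hinj
  refine ⟨hs (fin_zero_lt_one hN), hs (fin_one_lt_two hN), fun k h0 h1 => ?_⟩
  have := hanti (fin_two_le hN (k := (sortedRanking x).symm k)
    (fun e => h0 ((Equiv.symm_apply_eq _).1 e)) (fun e => h1 ((Equiv.symm_apply_eq _).1 e)))
  simpa using this

/-- Uniqueness of the top three lets a triple exhibited by hand be matched with positions `0`, `1`,
`2` of the mechanism. -/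
lemma IsTopThree.eq_sortedRanking (hN : 3 ≤ N) {x : Fin N → ℝ} (hx : Function.Injective x)
    {a b c : Fin N} (ht : IsTopThree x a b c) :
    sortedRanking x 0 = a ∧ sortedRanking x 1 = b ∧ sortedRanking x 2 = c := by
  have hs := isTopThree_sortedRanking hN hx
  have h0 : sortedRanking x 0 = a := by
    by_contra hne
    rcases eq_or_ne a (sortedRanking x 0) with e | e
    · exact hne e.symm
    · have := ht.le_second _ hne
      have := hs.le_second _ e
      have := ht.second_lt_first
      have := hs.second_lt_first
      linarith
  have h1 : sortedRanking x 1 = b := by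
    by_contra hne
    have hne0 : sortedRanking x 1 ≠ a := h0 ▸ hs.ne_first_second.symm
    have := ht.le_third _ hne0 hne
    have := hs.le_third b (h0 ▸ ht.ne_first_second.symm) (Ne.symm hne)
    have := ht.third_lt_second
    have := hs.third_lt_second
    linarith
  refine ⟨h0, h1, hx (le_antisymm ?_ ?_)⟩
  · exact ht.le_third _ (h0 ▸ hs.ne_first_third.symm) (h1 ▸ hs.ne_second_third.symm)
  · exact hs.le_third _ (h0 ▸ ht.ne_first_third.symm) (h1 ▸ ht.ne_second_third.symm)

lemma IsTopThree.marginalRevenue_eq (hN : 3 ≤ N) {x : Fin N → ℝ} (hx : Function.Injective x)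
    {a b c : Fin N} (ht : IsTopThree x a b c) :
    marginalRevenue μ f x = virtualValue μ f (x b) + x b - x c := by
  obtain ⟨-, h1, h2⟩ := ht.eq_sortedRanking hN hx
  rw [marginalRevenue, orderStat_eq, orderStat_eq, h1, h2]

end Fin

/-! ### The gain in virtual surplus from serving each buyer. -/

/-- The second-auction payoff with the own valuation replaced by its virtual value. -/
def virtualPayoff (μ : Measure ℝ) (f : ℝ → ℝ) (x : Fin N → ℝ) (S : Finset (Fin N)) (i : Fin N) :
    ℝ :=
  secondAuctionPayoff x S i - invHazard μ f (x i) * secondAuctionSlope x S i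

lemma virtualPayoff_eq_zero {x : Fin N → ℝ} {S : Finset (Fin N)} {i m : Fin N} (hm : m ∈ S)
    (hle : x i ≤ x m) : virtualPayoff μ f x S i = 0 := by
  have : x i ≤ S.fold max 0 x := (Finset.le_fold_max _).2 (Or.inr ⟨m, hm, hle⟩)
  rw [virtualPayoff, secondAuctionPayoff, secondAuctionSlope, if_neg this.not_gt,
    max_eq_right (sub_nonpos.2 this)]
  ring

lemma virtualPayoff_eq {x : Fin N → ℝ} {S : Finset (Fin N)} {i m : Fin N} (hm : m ∈ S)
    (h0 : 0 ≤ x m) (hmax : ∀ k ∈ S, x k ≤ x m) (hlt : x m < x i) :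
    virtualPayoff μ f x S i = virtualValue μ f (x i) - x m := by
  rw [virtualPayoff, secondAuctionPayoff, secondAuctionSlope, fold_max_eq hm h0 hmax, if_pos hlt,
    max_eq_left (sub_nonneg.2 hlt.le), virtualValue_eq]
  ring

/-- The effect on the virtual surplus of giving the good to buyer `j`. -/
def virtualGain (μ : Measure ℝ) (f : ℝ → ℝ) (x : Fin N → ℝ) (j : Fin N) : ℝ :=
  virtualValue μ f (x j) - virtualPayoff μ f x (Finset.univ.erase j) j
    + ∑ i ∈ Finset.univ.erase j, (virtualPayoff μ f x ((Finset.univ.erase i).erase j) i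
        - virtualPayoff μ f x (Finset.univ.erase i) i)

namespace DirectMechanism

lemma virtualSurplus_eq_average (M : DirectMechanism N) (x : Fin N → ℝ) (i : Fin N) :
    M.virtualSurplus μ f x i
      = M.average x i (virtualValue μ f (x i)) fun S => virtualPayoff μ f x S i := by
  have := M.average_sub_mul x i (x i) 1 (invHazard μ f (x i))
    (fun S => secondAuctionPayoff x S i) (fun S => secondAuctionSlope x S i)
  rw [mul_one] at this
  simp only [virtualSurplus, grossPayoff_eq_average, grossSlope, virtualPayoff, virtualValue_eq]
  exact this.symm

lemma virtualSurplus_inactive (x : Fin N → ℝ) (i : Fin N) :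
    (inactive N).virtualSurplus μ f x i = virtualPayoff μ f x (Finset.univ.erase i) i := by
  simp [virtualSurplus_eq_average, average, inactive]

/-- Surplus is summed by beneficiary `i`; exchanging the double sum regroups it by recipient `j` of
the good. -/
lemma sum_virtualSurplus_sub_inactive (M : DirectMechanism N) (x : Fin N → ℝ) :
    ∑ i, (M.virtualSurplus μ f x i - (inactive N).virtualSurplus μ f x i)
      = ∑ j, M.alloc x j * virtualGain μ f x j := by
  have h1 : ∀ i, M.virtualSurplus μ f x i - (inactive N).virtualSurplus μ f x i
      = M.alloc x i * (virtualValue μ f (x i) - virtualPayoff μ f x (Finset.univ.erase i) i)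
        + ∑ j ∈ Finset.univ.erase i, M.alloc x j *
          (virtualPayoff μ f x ((Finset.univ.erase i).erase j) i
            - virtualPayoff μ f x (Finset.univ.erase i) i) := by
    intro i
    rw [virtualSurplus_inactive, virtualSurplus_eq_average, average,
      ← Finset.add_sum_erase _ _ (Finset.mem_univ i)]
    simp only [mul_sub, Finset.sum_sub_distrib, ← Finset.sum_mul]
    ring
  simp only [h1, virtualGain, mul_add, Finset.sum_add_distrib, Finset.mul_sum]
  congr 1
  refine Finset.sum_comm' fun i j => ?_
  simp [eq_comm]

end DirectMechanism

/-- The top buyer saves the price `x b`. Buyer `b` then wins the second auction at price `x c`,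
adding `ψ(x b) - x c`; all others still lose. -/
lemma IsTopThree.virtualGain_first {x : Fin N → ℝ} {a b c : Fin N} (ht : IsTopThree x a b c)
    (h0 : ∀ i, 0 ≤ x i) :
    virtualGain μ f x a = virtualValue μ f (x b) + x b - x c := by
  have hab := ht.ne_first_second
  have hbc := ht.ne_second_third
  have hac := ht.ne_first_third
  rw [virtualGain, virtualPayoff_eq (m := b) (by simp [hab.symm]) (h0 b)
    (fun k hk => ht.le_second k (Finset.ne_of_mem_erase hk)) ht.second_lt_first,
    Finset.sum_eq_single b]
  · rw [virtualPayoff_eq (m := c) (by simp [hac.symm, hbc.symm]) (h0 c)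
      (fun k hk => by simp at hk; exact ht.le_third k hk.1 hk.2) ht.third_lt_second,
      virtualPayoff_eq_zero (m := a) (by simp [hab]) ht.second_lt_first.le]
    ring
  · intro i hi hib
    have hia := Finset.ne_of_mem_erase hi
    have hle := ht.le_second i hia
    rw [virtualPayoff_eq_zero (m := b) (by simp [hab.symm, Ne.symm hib]) hle,
      virtualPayoff_eq_zero (m := b) (by simp [Ne.symm hib]) hle, sub_zero]
  · intro hb; simp [hab.symm] at hb

/-- Buyer `b` gains `ψ(x b)`, having won nothing before, and the price paid by `a` falls from `x b`
to `x c`. -/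
lemma IsTopThree.virtualGain_second {x : Fin N → ℝ} {a b c : Fin N} (ht : IsTopThree x a b c)
    (h0 : ∀ i, 0 ≤ x i) :
    virtualGain μ f x b = virtualValue μ f (x b) + x b - x c := by
  have hab := ht.ne_first_second
  have hbc := ht.ne_second_third
  have hac := ht.ne_first_third
  rw [virtualGain, virtualPayoff_eq_zero (m := a) (by simp [hab]) ht.second_lt_first.le,
    Finset.sum_eq_single a]
  · rw [virtualPayoff_eq (m := c) (by simp [hac.symm, hbc.symm]) (h0 c)
      (fun k hk => by simp at hk; exact ht.le_third k hk.2 hk.1)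
      (ht.third_lt_second.trans ht.second_lt_first),
      virtualPayoff_eq (m := b) (by simp [hab.symm]) (h0 b)
      (fun k hk => ht.le_second k (Finset.ne_of_mem_erase hk)) ht.second_lt_first]
    ring
  · intro i hi hia
    have hle := (ht.le_second i hia).trans ht.second_lt_first.le
    rw [virtualPayoff_eq_zero (m := a) (by simp [hab, Ne.symm hia]) hle,
      virtualPayoff_eq_zero (m := a) (by simp [Ne.symm hia]) hle, sub_zero]
  · intro ha; simp [hab] at ha

/-- The second auction is unaffected: `a` still wins and pays `x b`. -/
lemma IsTopThree.virtualGain_of_ne {x : Fin N → ℝ} {a b c j : Fin N} (ht : IsTopThree x a b c)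
    (h0 : ∀ i, 0 ≤ x i) (hja : j ≠ a) (hjb : j ≠ b) :
    virtualGain μ f x j = virtualValue μ f (x j) := by
  have hab := ht.ne_first_second
  rw [virtualGain, virtualPayoff_eq_zero (m := b) (by simp [hjb.symm]) (ht.le_second j hja),
    Finset.sum_eq_zero]
  · ring
  intro i hi
  by_cases hia : i = a
  · subst hia
    rw [virtualPayoff_eq (m := b) (by simp [hab.symm, hjb.symm]) (h0 b)
      (fun k hk => ht.le_second k (by simp at hk; exact hk.2)) ht.second_lt_first,
      virtualPayoff_eq (m := b) (by simp [hab.symm]) (h0 b)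
      (fun k hk => ht.le_second k (Finset.ne_of_mem_erase hk)) ht.second_lt_first, sub_self]
  · have hle := (ht.le_second i hia).trans ht.second_lt_first.le
    rw [virtualPayoff_eq_zero (m := a) (by simp [hja.symm, Ne.symm hia]) hle,
      virtualPayoff_eq_zero (m := a) (by simp [Ne.symm hia]) hle, sub_zero]

/-- For a buyer below the top two, `ψ(x j) ≤ ψ(x₂) ≤ ψ(x₂) + x₂ - x₃`. -/
lemma virtualGain_le_marginalRevenue [NeZero N] (hN : 3 ≤ N) (h : IsPrior lo hi μ f)
    (hψ : MonotoneOn (virtualValue μ f) (Icc lo hi)) {x : Fin N → ℝ}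
    (hx : ∀ i, x i ∈ Icc lo hi) (hinj : Function.Injective x) (j : Fin N) :
    virtualGain μ f x j ≤ marginalRevenue μ f x := by
  have ht := isTopThree_sortedRanking hN hinj
  have h0 : ∀ i, 0 ≤ x i := fun i => h.lo_nonneg.trans (hx i).1
  rw [ht.marginalRevenue_eq hN hinj]
  by_cases ha : j = sortedRanking x 0
  · rw [ha, ht.virtualGain_first h0]
  by_cases hb : j = sortedRanking x 1
  · rw [hb, ht.virtualGain_second h0]
  rw [ht.virtualGain_of_ne h0 ha hb]
  have := hψ (hx j) (hx _) (ht.le_second j ha)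
  have := ht.third_lt_second
  linarith

/-! ### Measurability, feasibility and explicit form of the mechanism. -/

lemma measurableSet_antitone (σ : Equiv.Perm (Fin N)) :
    MeasurableSet {x : Fin N → ℝ | Antitone fun k => x (σ k)} := by
  have : {x : Fin N → ℝ | Antitone fun k => x (σ k)}
      = ⋂ (k) (l) (_ : k ≤ l), {x | x (σ l) ≤ x (σ k)} := by
    ext x; simp [Antitone]
  rw [this]
  exact MeasurableSet.iInter fun k => MeasurableSet.iInter fun l => MeasurableSet.iInter fun _ =>
    measurableSet_le (measurable_pi_apply _) (measurable_pi_apply _)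

lemma measurable_orderStat (k : Fin N) : Measurable fun x : Fin N → ℝ => orderStat x k := by
  refine measurable_of_Ici fun c => ?_
  have : (fun x : Fin N → ℝ => orderStat x k) ⁻¹' Ici c
      = ⋃ σ : Equiv.Perm (Fin N), {x | Antitone fun k => x (σ k)} ∩ {x | c ≤ x (σ k)} := by
    ext x
    simp only [mem_preimage, mem_Ici, mem_iUnion, mem_inter_iff, mem_ofPred_eq]
    constructor
    · exact fun hc => ⟨sortedRanking x, antitone_sortedRanking x, hc⟩
    · rintro ⟨σ, hσ, hc⟩
      rwa [eq_orderStat_of_antitone hσ]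
  rw [this]
  exact MeasurableSet.iUnion fun σ => (measurableSet_antitone σ).inter
    (measurableSet_le measurable_const (measurable_pi_apply _))

/-- The index set depends on `x`; summing over all permutations with indicators of measurable sets
removes this dependence. -/
lemma measurable_average_rankings {r : (Fin N → ℝ) → Fin N → ℝ}
    (hr : ∀ k, Measurable fun x => r x k) (i : Fin N) :
    Measurable fun x => (∑ σ ∈ rankings x, r x (σ⁻¹ i)) / (rankings x).card := by
  classical
  have h1 : ∀ x, ∑ σ ∈ rankings x, r x (σ⁻¹ i)
      = ∑ σ : Equiv.Perm (Fin N), if Antitone fun k => x (σ k) then r x (σ⁻¹ i) else 0 := by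
    intro x
    rw [← Finset.sum_filter]
    exact Finset.sum_congr (by ext σ; simp [mem_rankings]) fun _ _ => rfl
  have h2 : ∀ x : Fin N → ℝ, ((rankings x).card : ℝ)
      = ∑ σ : Equiv.Perm (Fin N), if Antitone fun k => x (σ k) then (1 : ℝ) else 0 := by
    intro x
    rw [← Finset.sum_filter, Finset.sum_const, nsmul_eq_mul, mul_one]
    congr 2
  simp only [h1, h2]
  refine Measurable.div ?_ ?_
  · exact Finset.measurable_fun_sum _ fun σ _ =>
      Measurable.ite (measurableSet_antitone σ) (hr _) measurable_const
  · exact Finset.measurable_fun_sum _ fun σ _ =>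
      Measurable.ite (measurableSet_antitone σ) measurable_const measurable_const

lemma card_rankings_pos (x : Fin N → ℝ) : 0 < ((rankings x).card : ℝ) := by
  exact_mod_cast Finset.card_pos.2 ⟨sortedRanking x, mem_rankings.2 (antitone_sortedRanking x)⟩

section Mechanism

variable [NeZero N]

lemma IsPrior.measurable_marginalRevenue (h : IsPrior lo hi μ f) :
    Measurable fun x : Fin N → ℝ => marginalRevenue μ f x :=
  ((h.measurable_virtualValue.comp (measurable_orderStat 1)).add (measurable_orderStat 1)).sub
    (measurable_orderStat 2)

lemma measurable_rankAlloc (h : IsPrior lo hi μ f) (k : Fin N) :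
    Measurable fun x : Fin N → ℝ => rankAlloc μ f x k := by
  unfold rankAlloc
  refine Measurable.ite ?_ measurable_const measurable_const
  exact (measurableSet_le measurable_const h.measurable_marginalRevenue).inter
    (MeasurableSet.const _)

lemma measurable_rankPay (h : IsPrior lo hi μ f) (k : Fin N) :
    Measurable fun x : Fin N → ℝ => rankPay lo hi μ f x k := by
  have hthr : Measurable fun x : Fin N → ℝ => threshold lo hi μ f (orderStat x 2) :=
    h.measurable_threshold.comp (measurable_orderStat 2)
  unfold rankPay
  refine Measurable.ite (measurableSet_le measurable_const h.measurable_marginalRevenue) ?_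
    measurable_const
  refine Measurable.ite (measurableSet_lt
    (h.measurable_virtualValue.comp (measurable_orderStat 2)) measurable_const) ?_ ?_
  · exact Measurable.ite (MeasurableSet.const _) (hthr.sub (measurable_orderStat 2))
      (Measurable.ite (MeasurableSet.const _) hthr measurable_const)
  · exact Measurable.ite (MeasurableSet.const _) (measurable_orderStat 2) measurable_const

lemma rankAlloc_nonneg (x : Fin N → ℝ) (k : Fin N) : 0 ≤ rankAlloc μ f x k := by
  unfold rankAlloc; split_ifs <;> simp

lemma sum_rankAlloc_le_one (x : Fin N → ℝ) : ∑ k, rankAlloc μ f x k ≤ 1 := by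
  classical
  have : ∀ k, rankAlloc μ f x k ≤ if k = 1 then 1 else 0 := by
    intro k; unfold rankAlloc
    by_cases h1 : k = 1 <;> by_cases h2 : 0 ≤ marginalRevenue μ f x <;> simp [h1, h2]
  exact (Finset.sum_le_sum fun k _ => this k).trans (by simp)

lemma feasibleAt_secondBidderMechanism (x : Fin N → ℝ) :
    (secondBidderMechanism N lo hi μ f).FeasibleAt x := by
  refine ⟨fun i => div_nonneg (Finset.sum_nonneg fun σ _ => rankAlloc_nonneg x _)
    (card_rankings_pos x).le, ?_⟩
  simp only [secondBidderMechanism, ← Finset.sum_div]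
  rw [div_le_one (card_rankings_pos x), Finset.sum_comm]
  refine (Finset.sum_le_sum fun σ _ => ?_).trans (by simp : ∑ σ ∈ rankings x, (1 : ℝ) ≤ _)
  rw [Equiv.sum_comp σ⁻¹ fun k => rankAlloc μ f x k]
  exact sum_rankAlloc_le_one x

lemma IsPrior.threshold_mem (h : IsPrior lo hi μ f) {x : ℝ} (hx : x ∈ Icc lo hi) :
    threshold lo hi μ f x ∈ Icc lo hi := (h.isLeast_threshold hx).1.1

lemma IsPrior.le_threshold (h : IsPrior lo hi μ f) {x : ℝ} (hx : x ∈ Icc lo hi) :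
    x ≤ threshold lo hi μ f x := (h.isLeast_threshold hx).1.2.1

open Classical in
/-- On the type space, the two payment regimes are given by one formula. -/
lemma rankPay_eq (h : IsPrior lo hi μ f) (hN : 3 ≤ N) {x : Fin N → ℝ}
    (hx : ∀ i, x i ∈ Icc lo hi) (k : Fin N) :
    rankPay lo hi μ f x k = if 0 ≤ marginalRevenue μ f x then
      if k = 0 then threshold lo hi μ f (orderStat x 2) - orderStat x 2
      else if k = 1 then threshold lo hi μ f (orderStat x 2) else 0
    else 0 := by
  have h1 := fin_one_ne_zero hN
  unfold rankPay
  by_cases hneg : virtualValue μ f (orderStat x 2) < 0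
  · simp only [hneg, if_true]
  -- When `ψ(x₃) ≥ 0` the threshold is `x₃` itself, so the top buyer's fee is zero and the price is
  -- `x₃`.
  · have := h.threshold_eq_self (hx _ : orderStat x 2 ∈ Icc lo hi) (not_lt.1 hneg)
    change threshold lo hi μ f (orderStat x 2) = orderStat x 2 at this
    rw [this]
    by_cases h0 : k = 0
    · simp [h0, h1.symm, hneg]
    · simp [h0, hneg]

lemma abs_rankPay_le (h : IsPrior lo hi μ f) (hN : 3 ≤ N) {x : Fin N → ℝ}
    (hx : ∀ i, x i ∈ Icc lo hi) (k : Fin N) : |rankPay lo hi μ f x k| ≤ hi := by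
  have hx2 : orderStat x 2 ∈ Icc lo hi := hx _
  have h1 := h.threshold_mem hx2
  have h2 := h.le_threshold hx2
  have h3 := h.lo_nonneg
  have h4 := h.lo_lt_hi
  have h5 := hx2.1
  have h6 := h1.2
  rw [rankPay_eq h hN hx, abs_le]
  split_ifs <;> constructor <;> linarith

lemma abs_pay_le (h : IsPrior lo hi μ f) (hN : 3 ≤ N) {x : Fin N → ℝ}
    (hx : ∀ i, x i ∈ Icc lo hi) (i : Fin N) :
    |(secondBidderMechanism N lo hi μ f).pay x i| ≤ hi := by
  simp only [secondBidderMechanism]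
  rw [abs_div, abs_of_pos (card_rankings_pos x), div_le_iff₀ (card_rankings_pos x), mul_comm,
    ← nsmul_eq_mul]
  exact (Finset.abs_sum_le_sum_abs _ _).trans
    (Finset.sum_le_card_nsmul _ _ _ fun σ _ => abs_rankPay_le h hN hx _)

lemma measurable_alloc (h : IsPrior lo hi μ f) (i : Fin N) :
    Measurable fun x => (secondBidderMechanism N lo hi μ f).alloc x i :=
  measurable_average_rankings (measurable_rankAlloc h) i

lemma measurable_pay (h : IsPrior lo hi μ f) (i : Fin N) :
    Measurable fun x => (secondBidderMechanism N lo hi μ f).pay x i :=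
  measurable_average_rankings (measurable_rankPay h) i

lemma integrable_pay (h : IsPrior lo hi μ f) (hN : 3 ≤ N) (i : Fin N) :
    Integrable (fun x => (secondBidderMechanism N lo hi μ f).pay x i) (jointLaw N μ) := by
  have := h.isProbabilityMeasure_jointLaw (N := N)
  refine Integrable.of_bound (measurable_pay h i).aestronglyMeasurable hi ?_
  filter_upwards [h.ae_mem] with y hy
  exact abs_pay_le h hN (fun j => Ioo_subset_Icc_self (hy j)) i

lemma integrable_pay_update (h : IsPrior lo hi μ f) (hN : 3 ≤ N) (i : Fin N) {q : ℝ}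
    (hq : q ∈ Icc lo hi) :
    Integrable (fun y => (secondBidderMechanism N lo hi μ f).pay (Function.update y i q) i)
      (jointLaw N μ) := by
  have := h.isProbabilityMeasure_jointLaw (N := N)
  refine Integrable.of_bound
    ((measurable_pay h i).comp measurable_update_left).aestronglyMeasurable hi ?_
  filter_upwards [h.ae_mem] with y hy
  exact abs_pay_le h hN (update_mem hy hq) i

variable {b : Fin N → ℝ} {p s t : Fin N}

open Classical in
lemma IsTopThree.alloc_eq (hN : 3 ≤ N) (hb : Function.Injective b) (ht : IsTopThree b p s t)
    (j : Fin N) : (secondBidderMechanism N lo hi μ f).alloc b j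
      = if 0 ≤ marginalRevenue μ f b ∧ j = s then 1 else 0 := by
  obtain ⟨-, h1, -⟩ := ht.eq_sortedRanking hN hb
  have : (sortedRanking b)⁻¹ j = 1 ↔ j = s := by rw [Equiv.Perm.inv_eq_iff_eq, h1]
  simp only [secondBidderMechanism, rankings_eq_singleton hb, Finset.sum_singleton,
    Finset.card_singleton, Nat.cast_one, div_one, rankAlloc, this]

open Classical in
lemma IsTopThree.pay_eq (h : IsPrior lo hi μ f) (hN : 3 ≤ N) (hb : Function.Injective b)
    (hmem : ∀ i, b i ∈ Icc lo hi) (ht : IsTopThree b p s t) (j : Fin N) :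
    (secondBidderMechanism N lo hi μ f).pay b j
      = if 0 ≤ marginalRevenue μ f b then
          if j = p then threshold lo hi μ f (b t) - b t
          else if j = s then threshold lo hi μ f (b t) else 0
        else 0 := by
  obtain ⟨h0, h1, h2⟩ := ht.eq_sortedRanking hN hb
  have e0 : (sortedRanking b)⁻¹ j = 0 ↔ j = p := by rw [Equiv.Perm.inv_eq_iff_eq, h0]
  have e1 : (sortedRanking b)⁻¹ j = 1 ↔ j = s := by rw [Equiv.Perm.inv_eq_iff_eq, h1]
  simp only [secondBidderMechanism, rankings_eq_singleton hb, Finset.sum_singleton,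
    Finset.card_singleton, Nat.cast_one, div_one, rankPay_eq h hN hmem, e0, e1, orderStat_eq, h2]

lemma IsTopThree.marginalRevenue_nonneg_iff (h : IsPrior lo hi μ f)
    (hψ : MonotoneOn (virtualValue μ f) (Icc lo hi)) (hN : 3 ≤ N) (hb : Function.Injective b)
    (hmem : ∀ i, b i ∈ Icc lo hi) (ht : IsTopThree b p s t) :
    0 ≤ marginalRevenue μ f b ↔ threshold lo hi μ f (b t) ≤ b s := by
  rw [ht.marginalRevenue_eq hN hb, h.threshold_le_iff hψ (hmem t) (hmem s) ht.third_lt_second.le]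

lemma IsTopThree.grossPayoff_of_nonneg (hN : 3 ≤ N) (hb : Function.Injective b)
    (ht : IsTopThree b p s t) (h0 : 0 ≤ marginalRevenue μ f b) (v : Fin N → ℝ) {i : Fin N}
    (his : i ≠ s) : (secondBidderMechanism N lo hi μ f).grossPayoff v b i
      = secondAuctionPayoff v ((Finset.univ.erase i).erase s) i := by
  classical
  simp [DirectMechanism.grossPayoff, ht.alloc_eq hN hb, h0, his, his.symm]

lemma IsTopThree.grossPayoff_second (hN : 3 ≤ N) (hb : Function.Injective b)
    (ht : IsTopThree b p s t) (h0 : 0 ≤ marginalRevenue μ f b) (v : Fin N → ℝ) :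
    (secondBidderMechanism N lo hi μ f).grossPayoff v b s = v s := by
  classical
  simp [DirectMechanism.grossPayoff, ht.alloc_eq hN hb, h0]

lemma IsTopThree.grossPayoff_of_neg (hN : 3 ≤ N) (hb : Function.Injective b)
    (ht : IsTopThree b p s t) (h0 : marginalRevenue μ f b < 0) (v : Fin N → ℝ) (i : Fin N) :
    (secondBidderMechanism N lo hi μ f).grossPayoff v b i
      = secondAuctionPayoff v (Finset.univ.erase i) i := by
  classical
  simp [DirectMechanism.grossPayoff, ht.alloc_eq hN hb, h0.not_ge]

end Mechanism

/-! ### Incentives profile by profile. -/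

/-- The buyers `m` and `n` hold the two highest entries of `y` among the rivals of `i`. -/
structure IsTopRivals (y : Fin N → ℝ) (i m n : Fin N) : Prop where
  first_ne : m ≠ i
  second_ne : n ≠ i
  second_lt_first : y n < y m
  le_second : ∀ k, k ≠ i → k ≠ m → y k ≤ y n

namespace IsTopRivals

variable {y : Fin N → ℝ} {i m n : Fin N}

lemma first_ne_second (hr : IsTopRivals y i m n) : m ≠ n :=
  fun e => hr.second_lt_first.ne (by rw [e])

lemma le_first (hr : IsTopRivals y i m n) (k : Fin N) (hk : k ≠ i) : y k ≤ y m := by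
  by_cases hm : k = m
  · rw [hm]
  · exact (hr.le_second k hk hm).trans hr.second_lt_first.le

lemma secondAuctionPayoff_eq (hr : IsTopRivals y i m n) (h0 : ∀ k, 0 ≤ y k) (x : ℝ) :
    secondAuctionPayoff (Function.update y i x) (Finset.univ.erase i) i = max (x - y m) 0 := by
  rw [secondAuctionPayoff, fold_max_update (by simp), Function.update_self,
    fold_max_eq (m := m) (by simp [hr.first_ne]) (h0 m)
      fun k hk => hr.le_first k (Finset.ne_of_mem_erase hk)]

lemma secondAuctionPayoff_erase_first (hr : IsTopRivals y i m n) (h0 : ∀ k, 0 ≤ y k) (x : ℝ) :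
    secondAuctionPayoff (Function.update y i x) ((Finset.univ.erase i).erase m) i
      = max (x - y n) 0 := by
  rw [secondAuctionPayoff, fold_max_update (by simp), Function.update_self,
    fold_max_eq (m := n) (by simp [hr.second_ne, hr.first_ne_second.symm]) (h0 n)
      fun k hk => by simp at hk; exact hr.le_second k hk.2 hk.1]

lemma secondAuctionPayoff_erase_second (hr : IsTopRivals y i m n) (h0 : ∀ k, 0 ≤ y k) (x : ℝ) :
    secondAuctionPayoff (Function.update y i x) ((Finset.univ.erase i).erase n) i
      = max (x - y m) 0 := by
  rw [secondAuctionPayoff, fold_max_update (by simp), Function.update_self,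
    fold_max_eq (m := m) (by simp [hr.first_ne, hr.first_ne_second]) (h0 m)
      fun k hk => by simp at hk; exact hr.le_first k hk.2]

lemma isTopThree_of_gt_first (hr : IsTopRivals y i m n) {q : ℝ} (hq : y m < q) :
    IsTopThree (Function.update y i q) i m n := by
  refine ⟨?_, ?_, fun k hki hkm => ?_⟩
  · simpa [hr.first_ne] using hq
  · simpa [hr.first_ne, hr.second_ne] using hr.second_lt_first
  · simpa [hr.second_ne, hki] using hr.le_second k hki hkm

lemma isTopThree_of_between (hr : IsTopRivals y i m n) {q : ℝ} (hq : q < y m) (hq' : y n < q) :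
    IsTopThree (Function.update y i q) m i n := by
  refine ⟨?_, ?_, fun k hkm hki => ?_⟩
  · simpa [hr.first_ne] using hq
  · simpa [hr.second_ne] using hq'
  · simpa [hr.second_ne, hki] using hr.le_second k hki hkm

/-- Who is third is left open: a buyer reporting below `y n` pays nothing and faces `m` in the
second auction in any case. -/
lemma isTopThree_of_lt_second (hr : IsTopRivals y i m n) (hy : Function.Injective y) {q : ℝ}
    (hq : q < y n) : ∃ t, IsTopThree (Function.update y i q) m n t := by
  classical
  obtain ⟨t, ht, hmax⟩ := Finset.exists_max_image ((Finset.univ.erase m).erase n)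
    (Function.update y i q) ⟨i, by simp [hr.first_ne.symm, hr.second_ne.symm]⟩
  simp only [Finset.mem_erase, Finset.mem_univ, and_true] at ht hmax
  refine ⟨t, ?_, ?_, fun k hkm hkn => hmax k ⟨hkn, hkm⟩⟩
  · simpa [hr.first_ne, hr.second_ne] using hr.second_lt_first
  · by_cases hti : t = i
    · subst hti; simpa [hr.second_ne] using hq
    · have := (hr.le_second t hti ht.2).lt_of_ne fun e => ht.1 (hy e)
      simpa [hr.second_ne, hti] using this

end IsTopRivals

/-- Moving buyer `i` to a report below all others makes the top two of the whole ranking his top two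
rivals. -/
lemma exists_isTopRivals [NeZero N] (hN : 3 ≤ N) {y : Fin N → ℝ} (hy : Function.Injective y)
    (i : Fin N) {q : ℝ} (hq : ∀ k, q < y k) : ∃ m n, IsTopRivals y i m n := by
  have hinj : Function.Injective (Function.update y i q) :=
    update_injective hy fun j => (hq j).ne'
  have ht := isTopThree_sortedRanking hN hinj
  generalize sortedRanking (Function.update y i q) 0 = a at ht
  generalize sortedRanking (Function.update y i q) 1 = b at ht
  generalize sortedRanking (Function.update y i q) 2 = c at ht
  have hge : ∀ k, q ≤ Function.update y i q k := by
    intro k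
    by_cases hk : k = i
    · subst hk; simp
    · simpa [hk] using (hq k).le
  have hb : b ≠ i := by
    rintro rfl
    have := ht.third_lt_second
    rw [Function.update_self] at this
    exact absurd (hge c) this.not_ge
  have ha : a ≠ i := by
    rintro rfl
    have := ht.second_lt_first
    rw [Function.update_self] at this
    exact absurd (hge b) this.not_ge
  refine ⟨a, b, ha, hb, by simpa [ha, hb] using ht.second_lt_first, fun k hki hka => ?_⟩
  simpa [hki, hb] using ht.le_second k hka

/-- The payoff of a buyer with valuation `x` who reports `q` when the two highest rival reports are
`r₁` and `r₂`, and `a` is the threshold at `r₂`. -/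
def exPostPayoff (a r₁ r₂ q x : ℝ) : ℝ :=
  if r₁ < q then if a ≤ r₁ then max (x - r₂) 0 - (a - r₂) else max (x - r₁) 0
  else if r₂ < q then if a ≤ q then x - a else max (x - r₁) 0
  else max (x - r₁) 0

/-- If `a > r₁`, every report yields `max (x - r₁) 0`. If `a ≤ r₁`, reports from `a` on yield `x -
a` (when `x < r₂` and `q > r₁`, only the nonpositive `-(a - r₂)`), and lower reports yield `max (x -
r₁) 0 ≤ max (x - a) 0`. -/
lemma exPostPayoff_le {a r₁ r₂ : ℝ} (ha : r₂ ≤ a) (q x : ℝ) :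
    exPostPayoff a r₁ r₂ q x ≤ exPostPayoff a r₁ r₂ x x := by
  unfold exPostPayoff
  rcases max_cases (x - r₁) 0 with ⟨e1, _⟩ | ⟨e1, _⟩ <;>
  rcases max_cases (x - r₂) 0 with ⟨e2, _⟩ | ⟨e2, _⟩ <;>
  rw [e1, e2] <;> split_ifs <;> linarith

lemma le_exPostPayoff {a r₁ r₂ : ℝ} (ha : r₂ ≤ a) (x : ℝ) :
    max (x - r₁) 0 ≤ exPostPayoff a r₁ r₂ x x := by
  unfold exPostPayoff
  rcases max_cases (x - r₁) 0 with ⟨e1, _⟩ | ⟨e1, _⟩ <;>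
  rcases max_cases (x - r₂) 0 with ⟨e2, _⟩ | ⟨e2, _⟩ <;>
  rw [e1, e2] <;> split_ifs <;> linarith

lemma integrable_outsidePayoff (h : IsPrior lo hi μ f) (i : Fin N) {x : ℝ} (hx : x ∈ Icc lo hi) :
    Integrable (fun y => secondAuctionPayoff (Function.update y i x) (Finset.univ.erase i) i)
      (jointLaw N μ) := by
  have := h.isProbabilityMeasure_jointLaw (N := N)
  refine Integrable.of_bound ((measurable_secondAuctionPayoff _ i).comp
    measurable_update_left).aestronglyMeasurable hi (Filter.Eventually.of_forall fun y => ?_)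
  exact abs_secondAuctionPayoff_le (by simpa using h.lo_nonneg.trans hx.1) (by simpa using hx.2)

/-- Revenue is the expected gain in virtual surplus over the inactive mechanism, less the rents of
the lowest types. -/
lemma DirectMechanism.IsAdmissible.revenue_eq {M : DirectMechanism N}
    (hM : M.IsAdmissible lo hi μ) (h : IsPrior lo hi μ f) :
    Integrable (fun x => ∑ j, M.alloc x j * virtualGain μ f x j) (jointLaw N μ) ∧
    M.revenue μ = ∫ x, ∑ j, M.alloc x j * virtualGain μ f x j ∂(jointLaw N μ)
      - ∑ i, (M.interimPayoff μ i lo lo - outsideOption N μ i lo) := by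
  have h0 : (DirectMechanism.inactive N).IsAdmissible lo hi μ :=
    DirectMechanism.isAdmissible_inactive
  have hint : ∀ i, Integrable (fun x => M.virtualSurplus μ f x i
      - (DirectMechanism.inactive N).virtualSurplus μ f x i) (jointLaw N μ) := fun i =>
    (hM.integrable_virtualSurplus h i).sub (h0.integrable_virtualSurplus h i)
  simp only [← DirectMechanism.sum_virtualSurplus_sub_inactive]
  refine ⟨integrable_finsetSum _ fun i _ => hint i, ?_⟩
  rw [DirectMechanism.revenue, integral_finsetSum _ fun i _ => hM.integrable_pay i,
    integral_finsetSum _ fun i _ => hint i, ← Finset.sum_sub_distrib]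
  refine Finset.sum_congr rfl fun i _ => ?_
  -- Zero payments identify the benchmark's expected virtual surplus with the lowest type's outside
  -- option.
  have e := h0.integral_pay h i
  rw [DirectMechanism.interimPayoff_inactive] at e
  simp only [DirectMechanism.inactive, integral_zero] at e
  rw [hM.integral_pay h i, integral_sub (hM.integrable_virtualSurplus h i)
    (h0.integrable_virtualSurplus h i)]
  simp only [DirectMechanism.inactive]
  linarith

/-! ### Admissibility and optimality of the mechanism. -/

section Mechanism

variable [NeZero N]

lemma payoff_eq_exPostPayoff (h : IsPrior lo hi μ f)
    (hψ : MonotoneOn (virtualValue μ f) (Icc lo hi)) (hN : 3 ≤ N) {y : Fin N → ℝ} {i m n : Fin N}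
    (hy : ∀ j, y j ∈ Ioo lo hi) (hinj : Function.Injective y) {q x : ℝ} (hq : q ∈ Icc lo hi)
    (hqy : ∀ j, y j ≠ q) (hr : IsTopRivals y i m n) :
    (secondBidderMechanism N lo hi μ f).grossPayoff (Function.update y i x)
        (Function.update y i q) i
      - (secondBidderMechanism N lo hi μ f).pay (Function.update y i q) i
      = exPostPayoff (threshold lo hi μ f (y n)) (y m) (y n) q x := by
  have hb := update_injective (i := i) hinj hqy
  have hmem := update_mem (i := i) hy hq
  have h0 : ∀ k, 0 ≤ y k := fun k => h.lo_nonneg.trans (hy k).1.le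
  unfold exPostPayoff
  by_cases hqm : y m < q
  · have ht := hr.isTopThree_of_gt_first hqm
    have hiff := ht.marginalRevenue_nonneg_iff h hψ hN hb hmem
    rw [Function.update_of_ne hr.second_ne, Function.update_of_ne hr.first_ne] at hiff
    rw [if_pos hqm, ht.pay_eq h hN hb hmem, Function.update_of_ne hr.second_ne, if_pos rfl]
    by_cases hmr : 0 ≤ marginalRevenue μ f (Function.update y i q)
    · rw [if_pos hmr, if_pos (hiff.1 hmr), ht.grossPayoff_of_nonneg hN hb hmr _ hr.first_ne.symm,
        hr.secondAuctionPayoff_erase_first h0]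
    · rw [if_neg hmr, if_neg (mt hiff.2 hmr), ht.grossPayoff_of_neg hN hb (not_le.1 hmr),
        hr.secondAuctionPayoff_eq h0, sub_zero]
  have hqm' : q < y m := (not_lt.1 hqm).lt_of_ne (hqy m).symm
  rw [if_neg hqm]
  by_cases hqn : y n < q
  · have ht := hr.isTopThree_of_between hqm' hqn
    have hiff := ht.marginalRevenue_nonneg_iff h hψ hN hb hmem
    rw [Function.update_of_ne hr.second_ne, Function.update_self] at hiff
    rw [if_pos hqn, ht.pay_eq h hN hb hmem, Function.update_of_ne hr.second_ne,
      if_neg hr.first_ne.symm, if_pos rfl]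
    by_cases hmr : 0 ≤ marginalRevenue μ f (Function.update y i q)
    · rw [if_pos hmr, if_pos (hiff.1 hmr), ht.grossPayoff_second hN hb hmr, Function.update_self]
    · rw [if_neg hmr, if_neg (mt hiff.2 hmr), ht.grossPayoff_of_neg hN hb (not_le.1 hmr),
        hr.secondAuctionPayoff_eq h0, sub_zero]
  · have hqn' : q < y n := (not_lt.1 hqn).lt_of_ne (hqy n).symm
    obtain ⟨t, ht⟩ := hr.isTopThree_of_lt_second hinj hqn'
    rw [if_neg hqn, ht.pay_eq h hN hb hmem, if_neg hr.first_ne.symm, if_neg hr.second_ne.symm,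
      ite_self, sub_zero]
    -- Whether or not `n` is served, `m` remains the highest rival in the second auction.
    by_cases hmr : 0 ≤ marginalRevenue μ f (Function.update y i q)
    · rw [ht.grossPayoff_of_nonneg hN hb hmr _ hr.second_ne.symm,
        hr.secondAuctionPayoff_erase_second h0]
    · rw [ht.grossPayoff_of_neg hN hb (not_le.1 hmr), hr.secondAuctionPayoff_eq h0]

lemma integrable_payoff (h : IsPrior lo hi μ f) (hN : 3 ≤ N) (i : Fin N) {q x : ℝ}
    (hq : q ∈ Icc lo hi) (hx : x ∈ Icc lo hi) :
    Integrable (fun y => (secondBidderMechanism N lo hi μ f).grossPayoff (Function.update y i x)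
        (Function.update y i q) i
      - (secondBidderMechanism N lo hi μ f).pay (Function.update y i q) i) (jointLaw N μ) :=
  (DirectMechanism.integrable_grossPayoff_update (measurable_alloc h)
    (fun b _ => feasibleAt_secondBidderMechanism b) h i hq hx).sub
    (integrable_pay_update h hN i hq)

/-- Both incentive constraints hold for almost every profile of rival valuations and are then
integrated. -/
theorem isAdmissible_secondBidderMechanism (h : IsPrior lo hi μ f)
    (hψ : MonotoneOn (virtualValue μ f) (Icc lo hi)) (hN : 3 ≤ N) :
    (secondBidderMechanism N lo hi μ f).IsAdmissible lo hi μ where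
  measurable_alloc := measurable_alloc h
  measurable_pay := measurable_pay h
  integrable_pay := integrable_pay h hN
  integrable_interim_pay i _ hq := integrable_pay_update h hN i hq
  alloc_nonneg x _ := (feasibleAt_secondBidderMechanism x).1
  alloc_sum_le_one x _ := (feasibleAt_secondBidderMechanism x).2
  incentive_compatible i x hx q hq := by
    refine integral_mono_ae (integrable_payoff h hN i hq hx) (integrable_payoff h hN i hx hx) ?_
    filter_upwards [h.ae_generic q, h.ae_ne_const x] with y ⟨hy, hinj, hyq⟩ hyx
    obtain ⟨m, n, hr⟩ := exists_isTopRivals hN hinj i fun k => (hy k).1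
    simp only [payoff_eq_exPostPayoff h hψ hN hy hinj hq hyq hr,
      payoff_eq_exPostPayoff h hψ hN hy hinj hx hyx hr]
    exact exPostPayoff_le (h.le_threshold (Ioo_subset_Icc_self (hy n))) q x
  individually_rational i x hx := by
    refine integral_mono_ae (integrable_outsidePayoff h i hx) (integrable_payoff h hN i hx hx) ?_
    filter_upwards [h.ae_generic x] with y ⟨hy, hinj, hyx⟩
    obtain ⟨m, n, hr⟩ := exists_isTopRivals hN hinj i fun k => (hy k).1
    simp only [payoff_eq_exPostPayoff h hψ hN hy hinj hx hyx hr]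
    rw [hr.secondAuctionPayoff_eq fun k => h.lo_nonneg.trans (hy k).1.le]
    exact le_exPostPayoff (h.le_threshold (Ioo_subset_Icc_self (hy n))) x

/-- Individual rationality binds for the lowest type. -/
lemma interimPayoff_lo (h : IsPrior lo hi μ f)
    (hψ : MonotoneOn (virtualValue μ f) (Icc lo hi)) (hN : 3 ≤ N) (i : Fin N) :
    (secondBidderMechanism N lo hi μ f).interimPayoff μ i lo lo = outsideOption N μ i lo := by
  refine integral_congr_ae ?_
  filter_upwards [h.ae_generic lo] with y ⟨hy, hinj, hyx⟩
  obtain ⟨m, n, hr⟩ := exists_isTopRivals hN hinj i fun k => (hy k).1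
  simp only [payoff_eq_exPostPayoff h hψ hN hy hinj (left_mem_Icc.2 h.lo_lt_hi.le) hyx hr]
  rw [hr.secondAuctionPayoff_eq fun k => h.lo_nonneg.trans (hy k).1.le, exPostPayoff,
    if_neg (hy m).1.not_gt, if_neg (hy n).1.not_gt]

lemma integrable_max_marginalRevenue (h : IsPrior lo hi μ f) :
    Integrable (fun x : Fin N → ℝ => max (marginalRevenue μ f x) 0) (jointLaw N μ) := by
  have := h.isProbabilityMeasure_jointLaw (N := N)
  -- The bound comes from `ψ(x₂) ≤ x₂ ≤ hi` and `x₃ ≥ 0`.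
  refine Integrable.of_bound
    (h.measurable_marginalRevenue.max measurable_const).aestronglyMeasurable (2 * hi) ?_
  filter_upwards [h.ae_mem] with y hy
  have hlo := h.lo_nonneg
  have hlt := h.lo_lt_hi
  have h1 : orderStat y 1 < hi := (hy _).2
  have h2 : lo < orderStat y 2 := (hy _).1
  have h3 := h.virtualValue_le (orderStat y 1)
  rw [Real.norm_eq_abs, abs_of_nonneg (le_max_right _ _)]
  refine max_le ?_ (by linarith)
  rw [marginalRevenue]
  linarith

/-- Individual rationality makes the rents nonnegative, and a subprobability average of the gains is
at most the positive part of the largest. -/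
lemma revenue_le (h : IsPrior lo hi μ f) (hψ : MonotoneOn (virtualValue μ f) (Icc lo hi))
    (hN : 3 ≤ N) {M : DirectMechanism N} (hM : M.IsAdmissible lo hi μ) :
    M.revenue μ ≤ ∫ x, max (marginalRevenue μ f x) 0 ∂(jointLaw N μ) := by
  obtain ⟨hint, heq⟩ := hM.revenue_eq h
  have hrent : 0 ≤ ∑ i, (M.interimPayoff μ i lo lo - outsideOption N μ i lo) :=
    Finset.sum_nonneg fun i _ => sub_nonneg.2
      (hM.individually_rational i lo (left_mem_Icc.2 h.lo_lt_hi.le))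
  have hle : ∫ x, ∑ j, M.alloc x j * virtualGain μ f x j ∂(jointLaw N μ)
      ≤ ∫ x, max (marginalRevenue μ f x) 0 ∂(jointLaw N μ) := by
    refine integral_mono_ae hint (integrable_max_marginalRevenue h) ?_
    filter_upwards [h.ae_mem, h.ae_injective] with x hx hinj
    have hx' : ∀ i, x i ∈ Icc lo hi := fun i => Ioo_subset_Icc_self (hx i)
    calc ∑ j, M.alloc x j * virtualGain μ f x j
        ≤ ∑ j, M.alloc x j * max (marginalRevenue μ f x) 0 :=
          Finset.sum_le_sum fun j _ => mul_le_mul_of_nonneg_left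
            ((virtualGain_le_marginalRevenue hN h hψ hx' hinj j).trans (le_max_left _ _))
            (hM.alloc_nonneg x hx' j)
      _ = (∑ j, M.alloc x j) * max (marginalRevenue μ f x) 0 := (Finset.sum_mul _ _ _).symm
      _ ≤ max (marginalRevenue μ f x) 0 :=
          mul_le_of_le_one_left (le_max_right _ _) (hM.alloc_sum_le_one x hx')
  linarith

/-- Both estimates behind `revenue_le` are tight: the lowest types earn no rent, and a buyer with
maximal gain is served exactly when that gain is nonnegative. -/
lemma revenue_secondBidderMechanism (h : IsPrior lo hi μ f)
    (hψ : MonotoneOn (virtualValue μ f) (Icc lo hi)) (hN : 3 ≤ N) :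
    (secondBidderMechanism N lo hi μ f).revenue μ
      = ∫ x, max (marginalRevenue μ f x) 0 ∂(jointLaw N μ) := by
  rw [((isAdmissible_secondBidderMechanism h hψ hN).revenue_eq h).2]
  simp only [interimPayoff_lo h hψ hN, sub_self, Finset.sum_const_zero, sub_zero]
  refine integral_congr_ae ?_
  filter_upwards [h.ae_mem, h.ae_injective] with x hx hinj
  have ht := isTopThree_sortedRanking hN hinj
  have hg := ht.virtualGain_second (μ := μ) (f := f) fun i => h.lo_nonneg.trans (hx i).1.le
  rw [← ht.marginalRevenue_eq hN hinj] at hg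
  simp only [ht.alloc_eq hN hinj]
  by_cases hmr : 0 ≤ marginalRevenue μ f x
  · simp [hmr, hg]
  · simp [hmr, (not_le.1 hmr).le]

end Mechanism

end SeqAuction

end

theorem theorem1 (N : ℕ) [NeZero N] (hN : 3 ≤ N)
    (lo hi : ℝ) (hlo : 0 ≤ lo) (hlohi : lo < hi)
    -- the law `F` of one valuation, with a continuous density `f` on its support `[lo, hi]`
    (μ : Measure ℝ) [IsProbabilityMeasure μ] (f : ℝ → ℝ)
    (hμ : μ = volume.withDensity fun x => ENNReal.ofReal (f x))
    (hf_zero : ∀ x, x ∉ Icc lo hi → f x = 0)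
    (hf_cont : ContinuousOn f (Icc lo hi))
    (hf_pos : ∀ x ∈ Ico lo hi, 0 < f x)
    -- increasing virtual values
    (hψ : MonotoneOn (SeqAuction.virtualValue μ f) (Icc lo hi)) :
    -- the minimum that defines `a(x)` exists
    (∀ x ∈ Icc lo hi, IsLeast (SeqAuction.thresholdSet lo hi μ f x)
      (SeqAuction.threshold lo hi μ f x)) ∧
    -- for all reports: the good is allocated iff `x₍₂₎ ≥ a(x₍₃₎)`, and the stated payments
    -- are positive in each of the two cases
    (∀ x : Fin N → ℝ, (∀ i, x i ∈ Icc lo hi) →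
      (0 ≤ SeqAuction.marginalRevenue μ f x ↔
        SeqAuction.threshold lo hi μ f (SeqAuction.orderStat x 2) ≤ SeqAuction.orderStat x 1) ∧
      (SeqAuction.virtualValue μ f (SeqAuction.orderStat x 2) < 0 →
        0 < SeqAuction.threshold lo hi μ f (SeqAuction.orderStat x 2) - SeqAuction.orderStat x 2 ∧
        0 < SeqAuction.threshold lo hi μ f (SeqAuction.orderStat x 2)) ∧
      (0 ≤ SeqAuction.virtualValue μ f (SeqAuction.orderStat x 2) →
        0 ≤ SeqAuction.marginalRevenue μ f x ∧
        SeqAuction.threshold lo hi μ f (SeqAuction.orderStat x 2) = SeqAuction.orderStat x 2 ∧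
        0 < SeqAuction.orderStat x 2)) ∧
    -- the mechanism is optimal
    (SeqAuction.secondBidderMechanism N lo hi μ f).IsOptimal lo hi μ ∧
    -- its expected revenue
    Integrable (fun x => max (SeqAuction.marginalRevenue μ f x) 0) (SeqAuction.jointLaw N μ) ∧
    (SeqAuction.secondBidderMechanism N lo hi μ f).revenue μ =
      ∫ x, max (SeqAuction.marginalRevenue μ f x) 0 ∂(SeqAuction.jointLaw N μ) := by
  have h : SeqAuction.IsPrior lo hi μ f :=
    ⟨hlo, hlohi, inferInstance, hμ, hf_zero, hf_cont, hf_pos⟩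
  have hadm := SeqAuction.isAdmissible_secondBidderMechanism h hψ hN
  have hrev := SeqAuction.revenue_secondBidderMechanism h hψ hN
  refine ⟨fun x hx => h.isLeast_threshold hx, fun x hx => ?_, ⟨hadm, fun M hM => ?_⟩,
    SeqAuction.integrable_max_marginalRevenue h, hrev⟩
  · have h1 : SeqAuction.orderStat x 1 ∈ Icc lo hi := hx _
    have h2 : SeqAuction.orderStat x 2 ∈ Icc lo hi := hx _
    have h21 : SeqAuction.orderStat x 2 ≤ SeqAuction.orderStat x 1 :=
      SeqAuction.antitone_sortedRanking x (SeqAuction.fin_one_lt_two hN).le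
    refine ⟨(h.threshold_le_iff hψ h2 h1 h21).symm, fun hneg => ?_, fun hnn => ⟨?_,
      h.threshold_eq_self h2 hnn, h.pos_of_virtualValue_nonneg h2 hnn⟩⟩
    · have := h.lt_threshold h2 hneg
      exact ⟨sub_pos.2 this, (hlo.trans h2.1).trans_lt this⟩
    · have := hψ h2 h1 h21
      rw [SeqAuction.marginalRevenue]
      linarith
  · rw [hrev]
    exact SeqAuction.revenue_le h hψ hN hM
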